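/- Let $q$ be a prime power and let $\mathbb F_q$ be the finite field with $q$ elements. For subspaces $U,W$ of $\mathbb F_q^n$ let $d_S(U,W)=\dim(U+W)-\dim(U\cap W)$ be the subspace distance, and let $A_q(n,d,k)$ be the maximal cardinality of a set $\mathcal C$ of $k$-dimensional subspaces of $\mathbb F_q^n$ such that $d_S(U,W)\ge d$ for all distinct $U,W\in\mathcal C$. (1) For every prime power $q$, \[A_q(13,4,4)\ge A_q(8,4,4)\cdot q^{15}+q^{15}+2q^{13}+3q^{12}+5q^{11}+q^{10}+3q^9+6q^8+7q^7+5q^6+3q^5+3q^4+q^3+1,\] \[A_q(14,4,4)\ge A_q(8,4,4)\cdot q^{18}+q^{18}+2q^{16}+3q^{15}+5q^{14}+q^{13}+4q^{12}+6q^{11}+10q^{10}+8q^9+8q^8+4q^7+2q^6+q^5+2q^4+q^2+1,\] \[A_q(15,4,4)\ge A_q(8,4,4)\cdot q^{21}+q^{21}+2q^{19}+3q^{18}+5q^{17}+q^{16}+4q^{15}+6q^{14}+11q^{13}+10q^{12}+12q^{11}+9q^{10}+8q^9+4q^8+3q^7+2q^6+q^5+q^4+q^3+q^2+2q+1.\]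 (2) For $q\in\{2,3,4,5,7,8,9\}$ the following numerical bounds hold: - $A_2(13,4,4)\ge 157396313$ - $A_3(13,4,4)\ge 7793514240823$ - $A_4(13,4,4)\ge 18118665490931521$ - $A_5(13,4,4)\ge 7466568820575245751$ - $A_7(13,4,4)\ge 65745512221518213208951$ - $A_8(13,4,4)\ge 2418546150658513179095553$ - $A_9(13,4,4)\ge 58159941504105053602711351$ - $A_2(14,4,4)\ge 1259180741$ - $A_3(14,4,4)\ge 210424885305967$ - $A_4(14,4,4)\ge 1159594591440676369$ - $A_5(14,4,4)\ge 933321102572187066901$ - $A_7(14,4,4)\ge 22550710691980761970230475$ - $A_8(14,4,4)\ge 1238295629137158820126564417$ - $A_9(14,4,4)\ge 42398597356492584370649345569$ - $A_2(15,4,4)\ge 10073479745$ - $A_3(15,4,4)\ge 5681471907063670$ - $A_4(15,4,4)\ge 74214053852327765337$ - $A_5(15,4,4)\ge 116665137821525349488286$ - $A_7(15,4,4)\ge 7734893767349401489942798302$ - $A_8(15,4,4)\ge 634007362118225316632582459985$ - $A_9(15,4,4)\ge 30908577472883094009455515497142$ -/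

import Mathlib

namespace SubspaceCode

/-- The subspace distance `dim (U + W) - dim (U ∩ W)`. As `U ∩ W ≤ U + W`, the subtraction in
`ℕ` never truncates when `V` is finite-dimensional. -/
noncomputable def subspaceDist {F V : Type*} [Field F] [AddCommGroup V] [Module F V]
    (U W : Submodule F V) : ℕ :=
  Module.finrank F ↥(U ⊔ W) - Module.finrank F ↥(U ⊓ W)

/-- `C` is a constant dimension code in `F ^ n`: all codewords are `k`-dimensional subspaces,
and distinct codewords have subspace distance at least `d`. -/
def IsConstantDimCode {F : Type*} [Field F] {n : ℕ} (d k : ℕ)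
    (C : Finset (Submodule F (Fin n → F))) : Prop :=
  (∀ U ∈ C, Module.finrank F ↥U = k) ∧
    ∀ U ∈ C, ∀ W ∈ C, U ≠ W → d ≤ subspaceDist U W

/-- The set of sizes of the constant dimension codes in `F ^ n` with parameters `d`, `k`. -/
def codeSizes (F : Type*) [Field F] (n d k : ℕ) : Set ℕ :=
  {m | ∃ C : Finset (Submodule F (Fin n → F)), IsConstantDimCode d k C ∧ C.card = m}

/-- `A_q(n, d, k)` for a finite field `F` with `q` elements: the maximal size of a constant
dimension code of `k`-dimensional subspaces of `F ^ n` with minimum distance at least `d`. -/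
noncomputable def maxCodeSize (F : Type*) [Field F] (n d k : ℕ) : ℕ :=
  sSup (codeSizes F n d k)

theorem codeSizes_nonempty (F : Type*) [Field F] (n d k : ℕ) :
    (codeSizes F n d k).Nonempty :=
  ⟨0, ∅, by simp [IsConstantDimCode], rfl⟩

theorem codeSizes_bddAbove (F : Type*) [Field F] [Finite F] (n d k : ℕ) :
    BddAbove (codeSizes F n d k) := by
  have : Finite (Submodule F (Fin n → F)) :=
    Finite.of_injective (fun U => (U : Set (Fin n → F))) SetLike.coe_injective
  have := Fintype.ofFinite (Submodule F (Fin n → F))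
  refine ⟨Fintype.card (Submodule F (Fin n → F)), ?_⟩
  rintro m ⟨C, -, rfl⟩
  exact Finset.card_le_univ C

/-- Over a finite field the supremum is a maximum. -/
theorem isGreatest_maxCodeSize (F : Type*) [Field F] [Finite F] (n d k : ℕ) :
    IsGreatest (codeSizes F n d k) (maxCodeSize F n d k) :=
  ⟨Nat.sSup_mem (codeSizes_nonempty F n d k) (codeSizes_bddAbove F n d k),
    fun _ hm => le_csSup (codeSizes_bddAbove F n d k) hm⟩

end SubspaceCode

/-!
All codes below consist of `4`-dimensional subspaces, and minimum distance `4` means that two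
codewords meet in dimension at most `2`; `card_le_maxCodeSize` turns a family with this property
into a lower bound for `maxCodeSize`.

**From length `8` to length `8 + t`** (`linkage`). Let `S` be the span of the last `t` coordinates
of `F ^ (8 + t)`. Every codeword `U` of an optimal code in `F ^ 8` is lifted to the graphs of
`q ^ (3 * t)` linear maps `U → F ^ t` whose differences have rank at least `2`. These graphs avoid
`S`, so all subspaces meeting `S` in dimension at least `2` may be added as long as they form a code
themselves. They are taken as row spaces of reduced row echelon forms. If the pivot sets of two forms
share at most two elements, then the row spaces meet in dimension at most `2`, since leading
coordinates of common vectors are common pivots (`IsLed.finrank_inf_le`). Forms with the same pivots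
are separated if no difference of their free parts has rank one. The pivot sets are listed in
`pivotMasks13`, `pivotMasks14` and `pivotMasks15`.

**Matrices without rank one** (`exists_rankCode`). The liftings and the echelon forms need
large linear spaces of matrices with prescribed support which contain no matrix of rank one. If the support meets at most `m` rows
and columns, the equation `∑ M i j • (u i * w j) = 0` over an extension field of degree `m`, with
linearly independent `u i` and `w j`, defines such a space of codimension at most `m`, because a
rank one matrix factors the sum.

**Length `8`, `q ≥ 3`** (`maxCodeSize_eight_ge`). Write `F ^ 8 = A × A` with `A` of dimension `4`. A
parallelism partitions the lines of the projective space of `A` into `q ^ 2 + q + 1` classes of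
`q ^ 2 + 1` pairwise skew lines. For each pair of lines of one class, `q ^ 2` subspaces are chosen
whose projection to the first factor is the one line and whose intersection with the second factor
is the other (`code_of_parallelism`). With the graphs of a rank metric code on `A` and `0 × A` this
gives `q ^ 12 + q ^ 2 * (q ^ 2 + 1) ^ 2 * (q ^ 2 + q + 1) + 1` codewords. The parallelism
(`parallelLine`) consists of the regular spread of `K`-lines of `K × K`, `[K : F] = 2`, and of regular
spreads with one regulus reversed. It is built from an `F`-linear map `h : K → K` without eigenvectors
which is not `K`-linear (`exists_twisted_end`); this is where `q ≥ 3` is used.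

**Length `8`, `q = 2`** (`binary_maxCodeSize_ge`). Here the required `4801` codewords are given
explicitly. They form `43` orbits under a group of order `120`, generated by the Frobenius
automorphism of the field with `256` elements and the multiplications by the nonzero elements of its
subfield with `16` elements. Vectors are bytes and subspaces are `256`-bit numbers, so that an
intersection is a bitwise `and`, and the kernel compares all orbits with the representatives.
-/

namespace SubspaceCode

open Module
open scoped LinearAlgebra.Projectivization

/-! ### Families of subspaces and code sizes -/

/-- Two `4`-dimensional subspaces meeting in dimension at most `2` have subspace distance at
least `4`. -/
theorem four_le_subspaceDist {F V : Type*} [Field F] [AddCommGroup V] [Module F V]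
    [FiniteDimensional F V] {U W : Submodule F V} (hU : finrank F U = 4) (hW : finrank F W = 4)
    (h : finrank F ↥(U ⊓ W) ≤ 2) : 4 ≤ subspaceDist U W := by
  have := Submodule.finrank_sup_add_finrank_inf_eq U W
  unfold subspaceDist
  omega

/-- Conversely, in a code with minimum distance `4` distinct codewords meet in dimension at
most `2`. -/
theorem IsConstantDimCode.finrank_inf_le {F : Type*} [Field F] {n : ℕ}
    {C : Finset (Submodule F (Fin n → F))} (hC : IsConstantDimCode 4 4 C)
    {U W : Submodule F (Fin n → F)} (hU : U ∈ C) (hW : W ∈ C) (h : U ≠ W) :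
    finrank F ↥(U ⊓ W) ≤ 2 := by
  have h1 := Submodule.finrank_sup_add_finrank_inf_eq U W
  have h2 := hC.2 U hU W hW h
  have h3 := hC.1 U hU
  have h4 := hC.1 W hW
  unfold subspaceDist at h2
  omega

/-- A family of `4`-dimensional subspaces of an `n`-dimensional space which pairwise meet in
dimension at most `2` is a code; such a family is automatically injective. -/
theorem card_le_maxCodeSize {F V ι : Type*} [Field F] [Finite F] [AddCommGroup V] [Module F V]
    [FiniteDimensional F V] [Finite ι] {n : ℕ} (hV : finrank F V = n) (U : ι → Submodule F V)
    (hU : ∀ i, finrank F (U i) = 4)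
    (hUU : ∀ i j, i ≠ j → finrank F ↥(U i ⊓ U j) ≤ 2) :
    Nat.card ι ≤ maxCodeSize F n 4 4 := by
  classical
  have := Fintype.ofFinite ι
  have e : V ≃ₗ[F] (Fin n → F) := LinearEquiv.ofFinrankEq _ _ (by simp [hV])
  have hrank (W : Submodule F V) : finrank F ↥(W.map e.toLinearMap) = finrank F W :=
    LinearEquiv.finrank_map_eq e W
  have hinf (i j) (hij : i ≠ j) :
      finrank F ↥((U i).map e.toLinearMap ⊓ (U j).map e.toLinearMap) ≤ 2 := by
    rw [← Submodule.map_inf _ e.injective, hrank]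
    exact hUU i j hij
  have hinj : Function.Injective fun i => (U i).map e.toLinearMap := by
    intro i j hij
    by_contra hne
    have h1 := hinf i j hne
    simp only at hij
    rw [← hij, inf_idem, hrank, hU] at h1
    omega
  refine (isGreatest_maxCodeSize F n 4 4).2
    ⟨Finset.univ.image fun i => (U i).map e.toLinearMap, ⟨?_, ?_⟩, ?_⟩
  · simp only [Finset.mem_image, Finset.mem_univ, true_and, forall_exists_index,
      forall_apply_eq_imp_iff]
    intro i
    rw [hrank, hU]
  · simp only [Finset.mem_image, Finset.mem_univ, true_and, forall_exists_index,
      forall_apply_eq_imp_iff]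
    intro i j hne
    refine four_le_subspaceDist (by rw [hrank, hU]) (by rw [hrank, hU]) (hinf i j ?_)
    rintro rfl
    exact hne rfl
  · rw [Finset.card_image_of_injective _ hinj, Finset.card_univ, Nat.card_eq_fintype_card]

/-- A code attaining the maximal size, as an indexed family. -/
theorem exists_maxCode (F : Type*) [Field F] [Finite F] (n : ℕ) :
    ∃ C : Finset (Submodule F (Fin n → F)), C.card = maxCodeSize F n 4 4 ∧
      (∀ U ∈ C, finrank F U = 4) ∧
      ∀ U ∈ C, ∀ W ∈ C, U ≠ W → finrank F ↥(U ⊓ W) ≤ 2 := by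
  obtain ⟨C, hC, hcard⟩ := (isGreatest_maxCodeSize F n 4 4).1
  exact ⟨C, hcard, hC.1, fun U hU W hW h => hC.finrank_inf_le hU hW h⟩

/-! ### Linear algebra -/

theorem finrank_le_of_map_le {F V W : Type*} [Field F] [AddCommGroup V] [Module F V]
    [AddCommGroup W] [Module F W] [FiniteDimensional F W] {X : Submodule F V}
    {Y : Submodule F W} (f : V →ₗ[F] W) (hf : ∀ x ∈ X, f x = 0 → x = 0)
    (hX : ∀ x ∈ X, f x ∈ Y) : finrank F X ≤ finrank F Y := by
  refine LinearMap.finrank_le_finrank_of_injective (f := f.restrict hX) ?_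
  rw [← LinearMap.ker_eq_bot, LinearMap.ker_eq_bot']
  rintro ⟨x, hx⟩ h
  exact Subtype.ext (hf x hx (congrArg Subtype.val h))

/-- A linear map of rank at most one is the product of a scalar function and a vector. -/
theorem exists_smul_of_finrank_range_le_one {F V W : Type*} [Field F] [AddCommGroup V]
    [Module F V] [AddCommGroup W] [Module F W] [FiniteDimensional F V] (T : V →ₗ[F] W)
    (h : finrank F (LinearMap.range T) ≤ 1) : ∃ (c : V → F) (w : W), ∀ x, T x = c x • w := by
  obtain ⟨w, hw⟩ := finrank_le_one_iff.1 h
  choose c hc using hw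
  refine ⟨fun x => c ⟨T x, x, rfl⟩, w, fun x => ?_⟩
  have := congrArg Subtype.val (hc ⟨T x, x, rfl⟩)
  exact this.symm

/-! ### Matrices of prescribed shape without rank one matrices -/

theorem exists_linearIndepOn {F L R : Type*} [Field F] [AddCommGroup L] [Module F L]
    [FiniteDimensional F L] (S : Finset R) (hS : S.card ≤ finrank F L) :
    ∃ u : R → L, LinearIndepOn F u (S : Set R) := by
  classical
  have hle : Fintype.card S ≤ Fintype.card (Fin (finrank F L)) := by simpa using hS
  obtain ⟨j⟩ := Function.Embedding.nonempty_of_card_le hle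
  let b := finBasis F L
  refine ⟨fun i => if h : i ∈ S then b (j ⟨i, h⟩) else 0, ?_⟩
  have h := b.linearIndependent.comp j j.injective
  have heq : (fun i : (S : Set R) => (if h : (i : R) ∈ S then b (j ⟨i, h⟩) else 0 : L)) = b ∘ j := by
    ext ⟨i, hi⟩
    have hi' : i ∈ S := hi
    simp [hi']
  unfold LinearIndepOn
  rw [heq]
  exact h

theorem sum_smul_eq_zero_of_linearIndepOn {F L R : Type*} [Field F] [AddCommGroup L] [Module F L]
    [Fintype R] {S : Finset R} {u : R → L} (hu : LinearIndepOn F u (S : Set R)) {c : R → F}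
    (hc : ∀ i, c i ≠ 0 → i ∈ S) (h : ∑ i, c i • u i = 0) : c = 0 := by
  have h1 : ∑ i ∈ S, c i • u i = 0 := by
    rw [← h]
    refine Finset.sum_subset (Finset.subset_univ S) fun i _ hi => ?_
    have : c i = 0 := by
      by_contra h0
      exact hi (hc i h0)
    rw [this, zero_smul]
  have h2 := linearIndepOn_finset_iff.1 hu c h1
  ext i
  by_contra h0
  exact h0 (h2 i (hc i h0))

/-- Matrices supported on a set `D` of positions which meets at most `m` rows and at most `m`
columns: there is a linear space of them of dimension at least `D.card - m` which contains no
matrix of rank one. It is cut out by the equation `∑ M i j • (u i * w j) = 0` in an extension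
field of degree `m`, where the `u i` and the `w j` are linearly independent: a matrix
`c i * d j` satisfies it only if `∑ c i • u i` or `∑ d j • w j` vanishes. -/
theorem exists_rankCode (F : Type*) [Field F] [Finite F] {R C : Type*} [Fintype R] [Fintype C]
    [DecidableEq R] [DecidableEq C] (D : Finset (R × C)) {m : ℕ} (hm : 0 < m)
    (hR : (D.image Prod.fst).card ≤ m) (hC : (D.image Prod.snd).card ≤ m) :
    ∃ N : Submodule F (R × C → F), D.card ≤ finrank F N + m ∧
      (∀ M ∈ N, ∀ x, x ∉ D → M x = 0) ∧
      ∀ M ∈ N, (∃ (c : R → F) (d : C → F), ∀ i j, M (i, j) = c i * d j) → M = 0 := by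
  classical
  obtain ⟨p, hp⟩ := CharP.exists F
  have hprime : Fact p.Prime := ⟨CharP.char_is_prime F p⟩
  have hm' : NeZero m := ⟨hm.ne'⟩
  let L := FiniteField.Extension F p m
  have hL : finrank F L = m := FiniteField.finrank_extension F p m
  obtain ⟨u, hu⟩ := exists_linearIndepOn (F := F) (L := L) _ (hR.trans_eq hL.symm)
  obtain ⟨w, hw⟩ := exists_linearIndepOn (F := F) (L := L) _ (hC.trans_eq hL.symm)
  let Φ : (R × C → F) →ₗ[F] L := Fintype.linearCombination F fun x => u x.1 * w x.2
  let Ρ : (R × C → F) →ₗ[F] ((Dᶜ : Finset (R × C)) → F) := LinearMap.funLeft F F Subtype.val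
  have hmem (M) : M ∈ LinearMap.ker (Φ.prod Ρ) ↔
      ∑ x, M x • (u x.1 * w x.2) = 0 ∧ ∀ x, x ∉ D → M x = 0 := by
    rw [LinearMap.mem_ker, LinearMap.prod_apply, Function.prod, Prod.mk_eq_zero]
    refine and_congr Iff.rfl ⟨fun h x hx => ?_, fun h => ?_⟩
    · exact congrFun h ⟨x, by simpa using hx⟩
    · ext ⟨x, hx⟩
      exact h x (by simpa using hx)
  refine ⟨LinearMap.ker (Φ.prod Ρ), ?_, fun M hM => ((hmem M).1 hM).2, ?_⟩
  · have h1 := LinearMap.finrank_range_add_finrank_ker (Φ.prod Ρ)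
    have h2 := Submodule.finrank_le (LinearMap.range (Φ.prod Ρ))
    rw [finrank_prod, hL, finrank_fintype_fun_eq_card, Fintype.card_coe] at h2
    rw [finrank_fintype_fun_eq_card] at h1
    have h3 := Finset.card_add_card_compl D
    omega
  · rintro M hM ⟨c, d, hcd⟩
    obtain ⟨hsum, hsupp⟩ := (hmem M).1 hM
    by_contra hM0
    obtain ⟨⟨i₀, j₀⟩, hij⟩ := Function.ne_iff.1 hM0
    rw [hcd, Pi.zero_apply] at hij
    have hc0 := left_ne_zero_of_mul hij
    have hd0 := right_ne_zero_of_mul hij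
    have hcS (i) (hi : c i ≠ 0) : i ∈ D.image Prod.fst := by
      refine Finset.mem_image.2 ⟨(i, j₀), ?_, rfl⟩
      by_contra hD
      exact mul_ne_zero hi hd0 ((hcd i j₀).symm.trans (hsupp _ hD))
    have hdS (j) (hj : d j ≠ 0) : j ∈ D.image Prod.snd := by
      refine Finset.mem_image.2 ⟨(i₀, j), ?_, rfl⟩
      by_contra hD
      exact mul_ne_zero hc0 hj ((hcd i₀ j).symm.trans (hsupp _ hD))
    have hprod : (∑ i, c i • u i) * (∑ j, d j • w j) = 0 := by
      rw [← hsum, Fintype.sum_prod_type, Finset.sum_mul_sum]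
      refine Finset.sum_congr rfl fun i _ => Finset.sum_congr rfl fun j _ => ?_
      rw [hcd, smul_mul_smul_comm]
    obtain h | h := mul_eq_zero.1 hprod
    · exact hc0 (congrFun (sum_smul_eq_zero_of_linearIndepOn hu hcS h) i₀)
    · exact hd0 (congrFun (sum_smul_eq_zero_of_linearIndepOn hw hdS h) j₀)

/-- Linear maps from a space of dimension `a` to a space of dimension `b`, `0 < a ≤ b`: there is a
linear space of them of dimension at least `a * b - b` whose nonzero members have rank at least
`2`. -/
theorem exists_homCode {F X Y : Type*} [Field F] [Finite F] [AddCommGroup X] [Module F X]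
    [AddCommGroup Y] [Module F Y] [FiniteDimensional F X] [FiniteDimensional F Y] {a b : ℕ}
    (hX : finrank F X = a) (hY : finrank F Y = b) (hb : 0 < b) (hab : a ≤ b) :
    ∃ N : Submodule F (X →ₗ[F] Y), Nat.card F ^ (a * b - b) ≤ Nat.card N ∧
      ∀ φ ∈ N, φ ≠ 0 → 2 ≤ finrank F (LinearMap.range φ) := by
  classical
  let bX := finBasisOfFinrankEq F X hX
  let bY := finBasisOfFinrankEq F Y hY
  let e : (Fin b × Fin a → F) ≃ₗ[F] (X →ₗ[F] Y) :=
    (LinearEquiv.curry F F (Fin b) (Fin a)).trans (LinearMap.toMatrix bX bY).symm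
  obtain ⟨N, hdim, -, hN⟩ := exists_rankCode F (Finset.univ : Finset (Fin b × Fin a)) hb
    ((Finset.card_le_univ _).trans_eq (by simp))
    ((Finset.card_le_univ _).trans (by simpa using hab))
  refine ⟨N.map e.toLinearMap, ?_, ?_⟩
  · rw [Module.natCard_eq_pow_finrank (K := F) (V := ↥(N.map e.toLinearMap)),
      LinearEquiv.finrank_map_eq]
    refine Nat.pow_le_pow_right Nat.card_pos ?_
    rw [Finset.card_univ, Fintype.card_prod, Fintype.card_fin, Fintype.card_fin] at hdim
    rw [mul_comm a b]
    omega
  · rintro _ ⟨M, hM, rfl⟩ hne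
    by_contra hlt
    obtain ⟨c, w, hcw⟩ := exists_smul_of_finrank_range_le_one (e M) (by
      change ¬ 2 ≤ finrank F (LinearMap.range (e M)) at hlt
      omega)
    refine hne ?_
    have : M = 0 := by
      refine hN M hM ⟨fun j => bY.repr w j, fun i => c (bX i), fun j i => ?_⟩
      have h1 : M (j, i) = LinearMap.toMatrix bX bY (e M) j i :=
        congrFun₂ ((LinearMap.toMatrix bX bY).apply_symm_apply
          (LinearEquiv.curry F F (Fin b) (Fin a) M)).symm j i
      rw [h1, LinearMap.toMatrix_apply, hcw, map_smul]
      simp [mul_comm]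
    rw [this, map_zero]

/-! ### Subspaces in reduced row echelon form -/

/-- Leading coordinates of the nonzero vectors of `U` lie in `P`: a vector of `U` which vanishes
before a coordinate outside `P` vanishes there as well. -/
def IsLed {F κ : Type*} [Field F] [LinearOrder κ] (P : Finset κ) (U : Submodule F (κ → F)) : Prop :=
  ∀ v ∈ U, ∀ j, j ∉ P → (∀ i < j, v i = 0) → v j = 0

/-- A nonzero vector in both subspaces has its leading coordinate in both sets. -/
theorem IsLed.finrank_inf_le {F κ : Type*} [Field F] [LinearOrder κ] [Fintype κ]
    {P Q : Finset κ} {U W : Submodule F (κ → F)} (hU : IsLed P U) (hW : IsLed Q W) :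
    finrank F ↥(U ⊓ W) ≤ (P ∩ Q).card := by
  have h := finrank_le_of_map_le (X := U ⊓ W) (Y := (⊤ : Submodule F ((P ∩ Q : Finset κ) → F)))
    (LinearMap.funLeft F F Subtype.val) ?_ fun _ _ => trivial
  · rwa [finrank_top, finrank_fintype_fun_eq_card, Fintype.card_coe] at h
  · rintro v ⟨hvU, hvW⟩ hv
    ext j
    induction j using WellFoundedLT.induction with
    | _ j ih =>
      by_cases hP : j ∈ P
      · by_cases hQ : j ∈ Q
        · exact congrFun hv ⟨j, Finset.mem_inter.2 ⟨hP, hQ⟩⟩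
        · exact hW v hvW j hQ ih
      · exact hU v hvU j hP ih

/-- The positions which are free in a reduced row echelon form with set of pivots `P`, rows being
indexed by their pivots. -/
def freePositions {κ : Type*} [LinearOrder κ] [Fintype κ] (P : Finset κ) : Finset (κ × κ) :=
  Finset.univ.filter fun x => x.1 ∈ P ∧ x.2 ∉ P ∧ x.1 < x.2

/-- The row space of the reduced row echelon form with pivots `P` and free entries `M`. -/
def echelonSpace {F κ : Type*} [Field F] [LinearOrder κ] (P : Finset κ) (M : κ × κ → F) :
    Submodule F (κ → F) where
  carrier := {v | ∀ j, j ∉ P → v j = ∑ p ∈ P, v p * M (p, j)}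
  zero_mem' := by simp
  add_mem' := by
    intro v w hv hw j hj
    simp only [Pi.add_apply, add_mul, Finset.sum_add_distrib]
    rw [hv j hj, hw j hj]
  smul_mem' := by
    intro c v hv j hj
    simp only [Pi.smul_apply, smul_eq_mul, mul_assoc, ← Finset.mul_sum]
    rw [hv j hj]

section

variable {F κ : Type*} [Field F] [LinearOrder κ] {P : Finset κ} {M : κ × κ → F}

theorem mem_echelonSpace {v : κ → F} :
    v ∈ echelonSpace P M ↔ ∀ j, j ∉ P → v j = ∑ p ∈ P, v p * M (p, j) := Iff.rfl

theorem echelonSpace_ext {v : κ → F} (hv : v ∈ echelonSpace P M) (h : ∀ p ∈ P, v p = 0) :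
    v = 0 := by
  ext j
  by_cases hj : j ∈ P
  · exact h j hj
  · rw [mem_echelonSpace.1 hv j hj]
    exact Finset.sum_eq_zero fun p hp => by rw [h p hp, zero_mul]

theorem finrank_echelonSpace : finrank F (echelonSpace P M) = P.card := by
  let f : echelonSpace P M →ₗ[F] (P → F) :=
    (LinearMap.funLeft F F Subtype.val) ∘ₗ (echelonSpace P M).subtype
  have hf : Function.Bijective f := by
    constructor
    · rw [← LinearMap.ker_eq_bot, LinearMap.ker_eq_bot']
      rintro ⟨v, hv⟩ h
      exact Subtype.ext (echelonSpace_ext hv fun p hp => congrFun h ⟨p, hp⟩)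
    · intro x
      let y : κ → F := fun p => if hp : p ∈ P then x ⟨p, hp⟩ else 0
      let v : κ → F := fun j => if j ∈ P then y j else ∑ p ∈ P, y p * M (p, j)
      have hv (p) (hp : p ∈ P) : v p = y p := if_pos hp
      refine ⟨⟨v, fun j hj => ?_⟩, ?_⟩
      · rw [Finset.sum_congr rfl fun p hp => by rw [hv p hp]]
        exact if_neg hj
      · ext ⟨p, hp⟩
        change v p = _
        rw [hv p hp]
        exact dif_pos hp
  rw [(LinearEquiv.ofBijective f hf).finrank_eq, finrank_fintype_fun_eq_card, Fintype.card_coe]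

variable [Fintype κ]

theorem isLed_echelonSpace (hM : ∀ x, x ∉ freePositions P → M x = 0) :
    IsLed P (echelonSpace P M) := by
  intro v hv j hj hlt
  rw [mem_echelonSpace.1 hv j hj]
  refine Finset.sum_eq_zero fun p _ => ?_
  by_cases hpj : p < j
  · rw [hlt p hpj, zero_mul]
  · rw [hM _ (by simp [freePositions, hpj]), mul_zero]

/-- Two subspaces with the same pivots and a common subspace of codimension at most one differ by a
matrix of rank at most one. -/
theorem exists_eq_mul_of_finrank_inf {M' : κ × κ → F}
    (hM : ∀ x, x ∉ freePositions P → M x = 0) (hM' : ∀ x, x ∉ freePositions P → M' x = 0)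
    (h : P.card ≤ finrank F ↥(echelonSpace P M ⊓ echelonSpace P M') + 1) :
    ∃ c d : κ → F, ∀ i j, (M - M') (i, j) = c i * d j := by
  let T : (P → F) →ₗ[F] (κ → F) :=
    Fintype.linearCombination F fun (p : P) (j : κ) => (M - M') ((p : κ), j)
  have hker : finrank F ↥(echelonSpace P M ⊓ echelonSpace P M') ≤
      finrank F (LinearMap.ker T) := by
    refine finrank_le_of_map_le (LinearMap.funLeft F F Subtype.val) ?_ ?_
    · rintro v ⟨hv, -⟩ h0
      exact echelonSpace_ext hv fun p hp => congrFun h0 ⟨p, hp⟩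
    · rintro v ⟨hv, hv'⟩
      rw [LinearMap.mem_ker, Fintype.linearCombination_apply]
      ext j
      rw [Finset.sum_apply]
      change ∑ p : P, v p * (M ((p : κ), j) - M' ((p : κ), j)) = 0
      rw [Finset.sum_coe_sort P fun p => v p * (M (p, j) - M' (p, j))]
      by_cases hj : j ∈ P
      · refine Finset.sum_eq_zero fun p _ => ?_
        rw [hM _ (by simp [freePositions, hj]), hM' _ (by simp [freePositions, hj]), sub_zero,
          mul_zero]
      · simp only [mul_sub, Finset.sum_sub_distrib]
        rw [← mem_echelonSpace.1 hv j hj, ← mem_echelonSpace.1 hv' j hj, sub_self]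
  have hrange : finrank F (LinearMap.range T) ≤ 1 := by
    have := LinearMap.finrank_range_add_finrank_ker T
    rw [finrank_fintype_fun_eq_card, Fintype.card_coe] at this
    omega
  obtain ⟨c, w, hcw⟩ := exists_smul_of_finrank_range_le_one T hrange
  refine ⟨fun p => if hp : p ∈ P then c (Pi.single ⟨p, hp⟩ 1) else 0, w, fun p j => ?_⟩
  by_cases hp : p ∈ P
  · have := congrFun (hcw (Pi.single ⟨p, hp⟩ 1)) j
    rw [Fintype.linearCombination_apply_single, one_smul] at this
    simpa [hp] using this
  · rw [Pi.sub_apply, hM _ (by simp [freePositions, hp]), hM' _ (by simp [freePositions, hp])]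
    simp [hp]

end

/-- The dimension of the space of matrices supplied by `exists_rankCode` for the free positions of a
reduced row echelon form; the `1` covers the case without free positions, in which the truncated
difference is `0`. -/
def levelDim {κ : Type*} [LinearOrder κ] [Fintype κ] (P : Finset κ) : ℕ :=
  (freePositions P).card -
    max (max ((freePositions P).image Prod.fst).card ((freePositions P).image Prod.snd).card) 1

/-- Free parts of echelon forms with pivots `P` such that the row spaces pairwise meet in
codimension at least `2`. -/
theorem exists_levelCode (F : Type*) [Field F] [Finite F] {κ : Type*} [LinearOrder κ] [Fintype κ]
    (P : Finset κ) : ∃ N : Submodule F (κ × κ → F), Nat.card F ^ levelDim P ≤ Nat.card N ∧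
      (∀ M ∈ N, ∀ x, x ∉ freePositions P → M x = 0) ∧
      ∀ M ∈ N, ∀ M' ∈ N, M ≠ M' →
        finrank F ↥(echelonSpace P M ⊓ echelonSpace P M') + 2 ≤ max 2 P.card := by
  obtain ⟨N, h1, h2, h3⟩ := exists_rankCode F (freePositions P)
    (m := max (max ((freePositions P).image Prod.fst).card
      ((freePositions P).image Prod.snd).card) 1)
    (by simp) (by simp) (by simp)
  refine ⟨N, ?_, h2, fun M hM M' hM' hne => ?_⟩
  · rw [Module.natCard_eq_pow_finrank (K := F) (V := N)]
    refine Nat.pow_le_pow_right Nat.card_pos ?_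
    unfold levelDim
    omega
  · by_contra hlt
    refine hne (sub_eq_zero.1 (h3 _ (N.sub_mem hM hM') ?_))
    exact exists_eq_mul_of_finrank_inf (h2 M hM) (h2 M' hM') (by omega)

/-! ### Linkage with a multilevel code -/

/-- The identification of `F ^ (s + t)` with `F ^ s × F ^ t`. -/
def splitEquiv (F : Type*) [Field F] (s t : ℕ) :
    (Fin (s + t) → F) ≃ₗ[F] (Fin s → F) × (Fin t → F) :=
  (LinearEquiv.funCongrLeft F F finSumFinEquiv).trans
    (LinearEquiv.sumArrowLequivProdArrow (Fin s) (Fin t) F F)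

/-- The graph of a linear map on a subspace `U` of `F ^ s`, as a subspace of `F ^ (s + t)`. -/
def graphSpace {F : Type*} [Field F] {s t : ℕ} (U : Submodule F (Fin s → F))
    (φ : U →ₗ[F] (Fin t → F)) : Submodule F (Fin (s + t) → F) :=
  LinearMap.range ((splitEquiv F s t).symm.toLinearMap ∘ₗ U.subtype.prod φ)

section

variable {F : Type*} [Field F] {s t : ℕ}

theorem mem_graphSpace {U : Submodule F (Fin s → F)} {φ : U →ₗ[F] (Fin t → F)}
    {v : Fin (s + t) → F} :
    v ∈ graphSpace U φ ↔ ∃ u : U, splitEquiv F s t v = ((u : Fin s → F), φ u) := by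
  unfold graphSpace
  rw [LinearMap.mem_range]
  refine exists_congr fun u => ?_
  rw [LinearMap.comp_apply, LinearEquiv.coe_coe, LinearEquiv.symm_apply_eq, eq_comm]
  rfl

theorem finrank_graphSpace (U : Submodule F (Fin s → F)) (φ : U →ₗ[F] (Fin t → F)) :
    finrank F (graphSpace U φ) = finrank F U := by
  refine LinearMap.finrank_range_of_inj ((splitEquiv F s t).symm.injective.comp ?_)
  intro u u' h
  exact Subtype.ext (congrArg Prod.fst h)

theorem eq_zero_of_mem_graphSpace {U : Submodule F (Fin s → F)} {φ : U →ₗ[F] (Fin t → F)}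
    {v : Fin (s + t) → F} (hv : v ∈ graphSpace U φ) (h : (splitEquiv F s t v).1 = 0) : v = 0 := by
  obtain ⟨u, hu⟩ := mem_graphSpace.1 hv
  rw [hu] at h
  have hu0 : u = 0 := Subtype.ext h
  rw [hu0, map_zero] at hu
  exact (splitEquiv F s t).map_eq_zero_iff.1 hu

theorem isLed_graphSpace (U : Submodule F (Fin s → F)) (φ : U →ₗ[F] (Fin t → F)) :
    IsLed (Finset.univ.filter fun i : Fin (s + t) => (i : ℕ) < s) (graphSpace U φ) := by
  intro v hv j hj hlt
  rw [eq_zero_of_mem_graphSpace hv, Pi.zero_apply]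
  ext i
  refine hlt (Fin.castAdd t i) ?_
  rw [Fin.lt_def, Fin.val_castAdd]
  simp only [Finset.mem_filter, Finset.mem_univ, true_and, not_lt] at hj
  exact i.2.trans_le hj

theorem finrank_graphSpace_inf_le {U U' : Submodule F (Fin s → F)} (φ : U →ₗ[F] (Fin t → F))
    (φ' : U' →ₗ[F] (Fin t → F)) :
    finrank F ↥(graphSpace U φ ⊓ graphSpace U' φ') ≤ finrank F ↥(U ⊓ U') := by
  refine finrank_le_of_map_le (LinearMap.fst F _ _ ∘ₗ (splitEquiv F s t).toLinearMap)
    (fun v hv h => eq_zero_of_mem_graphSpace hv.1 h) ?_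
  rintro v ⟨hv, hv'⟩
  obtain ⟨u, hu⟩ := mem_graphSpace.1 hv
  obtain ⟨u', hu'⟩ := mem_graphSpace.1 hv'
  refine ⟨?_, ?_⟩
  · change (splitEquiv F s t v).1 ∈ U
    rw [hu]
    exact u.2
  · change (splitEquiv F s t v).1 ∈ U'
    rw [hu']
    exact u'.2

theorem finrank_graphSpace_inf_add_le {U : Submodule F (Fin s → F)} (φ φ' : U →ₗ[F] (Fin t → F)) :
    finrank F ↥(graphSpace U φ ⊓ graphSpace U φ') + finrank F (LinearMap.range (φ - φ')) ≤
      finrank F U := by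
  rw [← LinearMap.finrank_range_add_finrank_ker (φ - φ'), add_comm]
  refine Nat.add_le_add_left ?_ _
  rw [(Submodule.equivMapOfInjective _ U.injective_subtype (LinearMap.ker (φ - φ'))).finrank_eq]
  refine finrank_le_of_map_le (LinearMap.fst F _ _ ∘ₗ (splitEquiv F s t).toLinearMap)
    (fun v hv h => eq_zero_of_mem_graphSpace hv.1 h) ?_
  rintro v ⟨hv, hv'⟩
  obtain ⟨u, hu⟩ := mem_graphSpace.1 hv
  obtain ⟨u', hu'⟩ := mem_graphSpace.1 hv'
  rw [hu, Prod.mk.injEq] at hu'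
  obtain rfl : u = u' := Subtype.ext hu'.1
  refine ⟨u, ?_, ?_⟩
  · simp [hu'.2]
  · change (u : Fin s → F) = (splitEquiv F s t v).1
    rw [hu]

end

/-- Linkage of an optimal code in `F ^ 8` with a multilevel code: the graphs of linear maps from
codewords of `F ^ 8` to `F ^ t`, and row spaces of echelon forms with at least two pivots among the
last `t` coordinates. -/
theorem linkage {F : Type*} [Field F] [Finite F] {t : ℕ} (ht : 4 ≤ t) {ι : Type*} [Fintype ι]
    (P : ι → Finset (Fin (8 + t))) (hcard : ∀ i, (P i).card = 4)
    (hhead : ∀ i, (Finset.univ.filter (fun j : Fin (8 + t) => (j : ℕ) < 8) ∩ P i).card ≤ 2)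
    (hpair : ∀ i j, i ≠ j → (P i ∩ P j).card ≤ 2) :
    maxCodeSize F 8 4 4 * Nat.card F ^ (3 * t) + ∑ i, Nat.card F ^ levelDim (P i) ≤
      maxCodeSize F (8 + t) 4 4 := by
  classical
  obtain ⟨C, hC, hC4, hCC⟩ := exists_maxCode F 8
  have hlift (U : C) : ∃ N : Submodule F ((U : Submodule F (Fin 8 → F)) →ₗ[F] (Fin t → F)),
      Nat.card F ^ (3 * t) ≤ Nat.card N ∧
        ∀ φ ∈ N, φ ≠ 0 → 2 ≤ finrank F (LinearMap.range φ) := by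
    have := exists_homCode (F := F) (X := (U : Submodule F (Fin 8 → F))) (Y := Fin t → F)
      (hC4 U U.2) (by simp) (by omega) ht
    rwa [show 4 * t - t = 3 * t by omega] at this
  choose N hN hN2 using hlift
  choose N' hN' hN'0 hN'2 using fun i => exists_levelCode F (P i)
  have hfin (U : C) : Finite ((U : Submodule F (Fin 8 → F)) →ₗ[F] (Fin t → F)) :=
    Module.finite_of_finite F
  let W : ((Σ U : C, N U) ⊕ Σ i, N' i) → Submodule F (Fin (8 + t) → F) :=
    Sum.elim (fun x => graphSpace (x.1 : Submodule F (Fin 8 → F)) x.2.1)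
      (fun x => echelonSpace (P x.1) x.2.1)
  have hmixed (x : Σ U : C, N U) (y : Σ i, N' i) : finrank F ↥(W (Sum.inl x) ⊓ W (Sum.inr y)) ≤ 2 :=
    ((isLed_graphSpace _ _).finrank_inf_le (isLed_echelonSpace (hN'0 y.1 _ y.2.2))).trans
      (hhead y.1)
  have hW := card_le_maxCodeSize (n := 8 + t) (by simp) W ?_ ?_
  · refine le_trans ?_ hW
    rw [Nat.card_sum, Nat.card_sigma, Nat.card_sigma, ← hC]
    refine Nat.add_le_add ?_ (Finset.sum_le_sum fun i _ => hN' i)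
    calc C.card * Nat.card F ^ (3 * t) = ∑ _U : C, Nat.card F ^ (3 * t) := by simp
      _ ≤ _ := Finset.sum_le_sum fun U _ => hN U
  · rintro (x | x)
    · exact (finrank_graphSpace _ _).trans (hC4 x.1 x.1.2)
    · exact finrank_echelonSpace.trans (hcard x.1)
  · rintro (⟨U, φ⟩ | ⟨i, M⟩) (⟨U', φ'⟩ | ⟨i', M'⟩) hne
    · by_cases hUU : U = U'
      · subst hUU
        have hφ : φ.1 - φ'.1 ≠ 0 := by
          rw [Ne, sub_eq_zero]
          intro h
          exact hne (by rw [Subtype.ext h])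
        have h1 := hN2 U _ ((N U).sub_mem φ.2 φ'.2) hφ
        have h2 := finrank_graphSpace_inf_add_le φ.1 φ'.1
        rw [hC4 U U.2] at h2
        change finrank F ↥(graphSpace (U : Submodule F (Fin 8 → F)) φ.1 ⊓ graphSpace _ φ'.1) ≤ 2
        omega
      · exact (finrank_graphSpace_inf_le _ _).trans
          (hCC U U.2 U' U'.2 fun h => hUU (Subtype.ext h))
    · exact hmixed _ _
    · rw [inf_comm]
      exact hmixed _ _
    · by_cases hii : i = i'
      · subst hii
        have := hN'2 i M M.2 M' M'.2 fun h => hne (by rw [Subtype.ext h])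
        rw [hcard] at this
        change finrank F ↥(echelonSpace (P i) M.1 ⊓ echelonSpace (P i) M'.1) ≤ 2
        omega
      · exact ((isLed_echelonSpace (hN'0 i _ M.2)).finrank_inf_le
          (isLed_echelonSpace (hN'0 i' _ M'.2))).trans (hpair i i' hii)

/-! ### Pivot sets of the multilevel codes -/

/-- The set of coordinates marked by the binary digits of `a`. -/
def maskSet (n a : ℕ) : Finset (Fin n) :=
  Finset.univ.filter fun i => a.testBit i = true

/-- The sets of pivots given by a list have four elements, at most two of which are among the first
eight coordinates, and any two sets have at most two elements in common. -/
def IsSkeleton (t : ℕ) (l : List ℕ) : Prop :=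
  (∀ a ∈ l, (maskSet (8 + t) a).card = 4 ∧
    (Finset.univ.filter (fun j : Fin (8 + t) => (j : ℕ) < 8) ∩ maskSet (8 + t) a).card ≤ 2) ∧
  l.Pairwise fun a b => (maskSet (8 + t) a ∩ maskSet (8 + t) b).card ≤ 2

instance (t : ℕ) (l : List ℕ) : Decidable (IsSkeleton t l) := by
  unfold IsSkeleton
  infer_instance

theorem linkage_skeleton (F : Type*) [Field F] [Finite F] {t : ℕ} (ht : 4 ≤ t) (l : List ℕ)
    (hl : IsSkeleton t l) :
    maxCodeSize F 8 4 4 * Nat.card F ^ (3 * t) +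
      (l.map fun a => Nat.card F ^ levelDim (maskSet (8 + t) a)).sum ≤
      maxCodeSize F (8 + t) 4 4 := by
  obtain ⟨h1, h2⟩ := hl
  rw [List.pairwise_iff_getElem] at h2
  have := linkage (F := F) ht (fun i : Fin l.length => maskSet (8 + t) l[i])
    (fun i => (h1 _ (List.getElem_mem _)).1) (fun i => (h1 _ (List.getElem_mem _)).2)
    (fun i j hij => by
      obtain h | h := lt_or_gt_of_ne hij
      · exact h2 i j i.2 j.2 h
      · rw [Finset.inter_comm]
        exact h2 j i j.2 i.2 h)
  rwa [← Fin.sum_univ_fun_getElem]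

/-- Pivot sets in `F ^ 13`, in decreasing order of `levelDim`. -/
def pivotMasks13 : List ℕ :=
  [771, 780, 1286, 1289, 1541, 2309, 816, 1546, 2314, 2566, 3075, 2569, 1360, 3084, 4369,
    960, 1440, 1632, 2400, 4392, 4626, 1680, 2448, 2640, 3120, 4420, 4641, 5144, 2720, 4482,
    4680, 5156, 6164, 4740, 5186, 6178, 3264, 5249, 6209, 6280, 6912]

theorem levelDim_pivotMasks13 : (pivotMasks13.map fun a => levelDim (maskSet 13 a)) =
  [15, 13, 13, 12, 12, 12, 11, 11, 11, 11, 11, 10, 9, 9, 9, 8, 8, 8, 8, 8, 8, 7, 7, 7, 7, 7,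
    7, 7, 6, 6, 6, 6, 6, 5, 5, 5, 4, 4, 4, 3, 0] := by
  decide +kernel

theorem isSkeleton_pivotMasks13 : IsSkeleton 5 pivotMasks13 := by decide +kernel

theorem maxCodeSize_13_ge (F : Type*) [Field F] [Finite F] {q : ℕ} (hq : Nat.card F = q) :
    maxCodeSize F 8 4 4 * q ^ 15 +
      (q ^ 15 + 2 * q ^ 13 + 3 * q ^ 12 + 5 * q ^ 11 + q ^ 10 + 3 * q ^ 9 + 6 * q ^ 8 + 7 *
        q ^ 7 + 5 * q ^ 6 + 3 * q ^ 5 + 3 * q ^ 4 + q ^ 3 + 1) ≤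
      maxCodeSize F 13 4 4 := by
  have h := linkage_skeleton F (t := 5) (by norm_num) pivotMasks13 isSkeleton_pivotMasks13
  have h2 := congrArg (fun l : List ℕ => (l.map fun d => q ^ d).sum) levelDim_pivotMasks13
  rw [List.map_map] at h2
  rw [hq] at h
  refine le_trans (le_of_eq ?_) h
  refine congrArg _ (Eq.trans ?_ h2.symm)
  simp only [List.map_cons, List.map_nil, List.sum_cons, List.sum_nil]
  ring

/-- Pivot sets in `F ^ 14`, in decreasing order of `levelDim`. -/
def pivotMasks14 : List ℕ :=
  [771, 780, 1285, 1290, 1542, 2310, 816, 1545, 2313, 2565, 3075, 2570, 960, 1360, 3084,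
    4376, 1440, 1632, 2400, 4388, 4628, 8465, 1680, 2448, 2640, 3120, 4418, 4648, 5137, 8488,
    8722, 12291, 2720, 4481, 4673, 5154, 6162, 8516, 8737, 9240, 3264, 4738, 5188, 6177, 8578,
    8776, 9252, 10260, 5256, 6216, 8836, 9282, 6276, 9345, 10376, 3840, 12480, 13056, 15360]

theorem levelDim_pivotMasks14 : (pivotMasks14.map fun a => levelDim (maskSet 14 a)) =
  [18, 16, 16, 15, 15, 15, 14, 14, 14, 14, 14, 13, 12, 12, 12, 12, 11, 11, 11, 11, 11, 11,
    10, 10, 10, 10, 10, 10, 10, 10, 10, 10, 9, 9, 9, 9, 9, 9, 9, 9, 8, 8, 8, 8, 8, 8, 8, 8, 7,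
    7, 7, 7, 6, 6, 5, 4, 4, 2, 0] := by
  decide +kernel

theorem isSkeleton_pivotMasks14 : IsSkeleton 6 pivotMasks14 := by decide +kernel

theorem maxCodeSize_14_ge (F : Type*) [Field F] [Finite F] {q : ℕ} (hq : Nat.card F = q) :
    maxCodeSize F 8 4 4 * q ^ 18 +
      (q ^ 18 + 2 * q ^ 16 + 3 * q ^ 15 + 5 * q ^ 14 + q ^ 13 + 4 * q ^ 12 + 6 * q ^ 11 + 10
        * q ^ 10 + 8 * q ^ 9 + 8 * q ^ 8 + 4 * q ^ 7 + 2 * q ^ 6 + q ^ 5 + 2 * q ^ 4 + q ^ 2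
        + 1) ≤
      maxCodeSize F 14 4 4 := by
  have h := linkage_skeleton F (t := 6) (by norm_num) pivotMasks14 isSkeleton_pivotMasks14
  have h2 := congrArg (fun l : List ℕ => (l.map fun d => q ^ d).sum) levelDim_pivotMasks14
  rw [List.map_map] at h2
  rw [hq] at h
  refine le_trans (le_of_eq ?_) h
  refine congrArg _ (Eq.trans ?_ h2.symm)
  simp only [List.map_cons, List.map_nil, List.sum_cons, List.sum_nil]
  ring

/-- Pivot sets in `F ^ 15`, in decreasing order of `levelDim`. -/
def pivotMasks15 : List ℕ :=
  [771, 780, 1285, 1290, 1542, 2310, 816, 1545, 2313, 2565, 3075, 2570, 960, 1360, 3084,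
    4369, 1440, 1632, 2400, 4388, 4626, 8468, 1680, 2448, 2640, 3120, 4418, 4648, 5144, 8481,
    8728, 12291, 16664, 2720, 4488, 4673, 5154, 6164, 8520, 8738, 9234, 16674, 16913, 3264,
    4740, 5188, 6177, 8578, 8772, 9256, 10257, 12300, 16705, 16932, 17428, 5249, 6216, 8833,
    9281, 10276, 16772, 16968, 17441, 18450, 6274, 9348, 10306, 12336, 17026, 17474, 18472,
    24586, 3840, 10376, 17544, 18500, 12480, 18561, 20576, 20624, 24656, 24736, 21248, 13568,
    26112, 14848, 26880, 23552]

theorem levelDim_pivotMasks15 : (pivotMasks15.map fun a => levelDim (maskSet 15 a)) =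
  [21, 19, 19, 18, 18, 18, 17, 17, 17, 17, 17, 16, 15, 15, 15, 15, 14, 14, 14, 14, 14, 14,
    13, 13, 13, 13, 13, 13, 13, 13, 13, 13, 13, 12, 12, 12, 12, 12, 12, 12, 12, 12, 12, 11,
    11, 11, 11, 11, 11, 11, 11, 11, 11, 11, 11, 10, 10, 10, 10, 10, 10, 10, 10, 10, 9, 9, 9,
    9, 9, 9, 9, 9, 8, 8, 8, 8, 7, 7, 7, 6, 6, 5, 4, 3, 2, 1, 1, 0] := by
  decide +kernel

theorem isSkeleton_pivotMasks15 : IsSkeleton 7 pivotMasks15 := by decide +kernel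

theorem maxCodeSize_15_ge (F : Type*) [Field F] [Finite F] {q : ℕ} (hq : Nat.card F = q) :
    maxCodeSize F 8 4 4 * q ^ 21 +
      (q ^ 21 + 2 * q ^ 19 + 3 * q ^ 18 + 5 * q ^ 17 + q ^ 16 + 4 * q ^ 15 + 6 * q ^ 14 + 11
        * q ^ 13 + 10 * q ^ 12 + 12 * q ^ 11 + 9 * q ^ 10 + 8 * q ^ 9 + 4 * q ^ 8 + 3 * q ^
        7 + 2 * q ^ 6 + q ^ 5 + q ^ 4 + q ^ 3 + q ^ 2 + 2 * q + 1) ≤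
      maxCodeSize F 15 4 4 := by
  have h := linkage_skeleton F (t := 7) (by norm_num) pivotMasks15 isSkeleton_pivotMasks15
  have h2 := congrArg (fun l : List ℕ => (l.map fun d => q ^ d).sum) levelDim_pivotMasks15
  rw [List.map_map] at h2
  rw [hq] at h
  refine le_trans (le_of_eq ?_) h
  refine congrArg _ (Eq.trans ?_ h2.symm)
  simp only [List.map_cons, List.map_nil, List.sum_cons, List.sum_nil]
  ring

/-! ### Codes in dimension eight from parallelisms -/

theorem finrank_graph {F A S : Type*} [Field F] [AddCommGroup A] [Module F A] [AddCommGroup S]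
    [Module F S] (φ : A →ₗ[F] S) : finrank F φ.graph = finrank F A := by
  rw [LinearMap.graph_eq_range_prod]
  exact LinearMap.finrank_range_of_inj fun a b h => congrArg Prod.fst h

/-- Bound by the dimensions of the projection to `A` and of the intersection with `S`. -/
theorem finrank_inf_le_add {F A S : Type*} [Field F] [AddCommGroup A] [Module F A]
    [AddCommGroup S] [Module F S] [FiniteDimensional F A] [FiniteDimensional F S]
    {X X' : Submodule F (A × S)} {Y : Submodule F A} {Z : Submodule F S}
    (hY : ∀ x ∈ X, x ∈ X' → x.1 ∈ Y) (hZ : ∀ s, ((0 : A), s) ∈ X → ((0 : A), s) ∈ X' → s ∈ Z) :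
    finrank F ↥(X ⊓ X') ≤ finrank F Y + finrank F Z := by
  rw [← LinearMap.finrank_range_add_finrank_ker ((LinearMap.fst F A S).domRestrict (X ⊓ X'))]
  refine Nat.add_le_add (Submodule.finrank_mono ?_) ?_
  · rintro _ ⟨⟨x, hx, hx'⟩, rfl⟩
    exact hY x hx hx'
  · refine finrank_le_of_map_le ((LinearMap.snd F A S).domRestrict (X ⊓ X')) ?_ ?_
    · intro x hx h
      exact Subtype.ext (Prod.ext hx h)
    · rintro ⟨⟨a, s⟩, hx, hx'⟩ h
      obtain rfl : a = 0 := h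
      exact hZ s hx hx'

section

variable {F A S K : Type*} [Field F] [AddCommGroup A] [Module F A] [AddCommGroup S] [Module F S]
  [Field K] [Algebra F K]

/-- The subspace of `A × S` with projection `U` to `A` and intersection `W` with `S` which is
determined by an identification `e` of `U` with the field `K`, a complement of `W`
parametrised by `σ`, and a number `κ`. -/
def blockSpace (U : Submodule F A) (W : Submodule F S) (e : U ≃ₗ[F] K) (σ : K →ₗ[F] S) (κ : K) :
    Submodule F (A × S) :=
  LinearMap.range ((U.subtype ∘ₗ LinearMap.fst F U W).prod
    (W.subtype ∘ₗ LinearMap.snd F U W + σ ∘ₗ LinearMap.mulLeft F κ ∘ₗ e.toLinearMap ∘ₗ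
      LinearMap.fst F U W))

theorem mem_blockSpace {U : Submodule F A} {W : Submodule F S} {e : U ≃ₗ[F] K} {σ : K →ₗ[F] S}
    {κ : K} {x : A × S} : x ∈ blockSpace U W e σ κ ↔
      ∃ (u : U) (w : W), x = ((u : A), (w : S) + σ (κ * e u)) := by
  unfold blockSpace
  rw [LinearMap.mem_range, Prod.exists]
  exact exists_congr fun u => exists_congr fun w => eq_comm

theorem finrank_blockSpace [FiniteDimensional F A] [FiniteDimensional F S] (U : Submodule F A)
    (W : Submodule F S) (e : U ≃ₗ[F] K) (σ : K →ₗ[F] S) (κ : K) : finrank F (blockSpace U W e σ κ) = finrank F U + finrank F W := by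
  unfold blockSpace
  rw [LinearMap.finrank_range_of_inj, finrank_prod]
  rintro ⟨u, w⟩ ⟨u', w'⟩ h
  have h1 : u = u' := Subtype.ext (congrArg Prod.fst h)
  subst h1
  have h2 : (w : S) + σ (κ * e u) = w' + σ (κ * e u) := congrArg Prod.snd h
  rw [Subtype.ext (add_right_cancel h2)]

theorem fst_mem_of_mem_blockSpace {U : Submodule F A} {W : Submodule F S} {e : U ≃ₗ[F] K}
    {σ : K →ₗ[F] S} {κ : K} {x : A × S} (hx : x ∈ blockSpace U W e σ κ) : x.1 ∈ U := by
  obtain ⟨u, w, rfl⟩ := mem_blockSpace.1 hx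
  exact u.2

theorem mem_of_inr_mem_blockSpace {U : Submodule F A} {W : Submodule F S} {e : U ≃ₗ[F] K}
    {σ : K →ₗ[F] S} {κ : K} {s : S} (hs : ((0 : A), s) ∈ blockSpace U W e σ κ) : s ∈ W := by
  obtain ⟨u, w, h⟩ := mem_blockSpace.1 hs
  rw [Prod.mk.injEq] at h
  obtain rfl : u = 0 := Subtype.ext h.1.symm
  rw [h.2, map_zero, mul_zero, map_zero, add_zero]
  exact w.2

theorem finrank_blockSpace_inf_le [FiniteDimensional F A] [FiniteDimensional F S]
    {U : Submodule F A} {W : Submodule F S} {e : U ≃ₗ[F] K}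
    {σ : K →ₗ[F] S} (hσ : ∀ k, σ k ∈ W → k = 0) {κ κ' : K} (h : κ ≠ κ') :
    finrank F ↥(blockSpace U W e σ κ ⊓ blockSpace U W e σ κ') ≤ finrank F W := by
  refine (finrank_inf_le_add (Y := ⊥) (Z := W) ?_
    fun s hs _ => mem_of_inr_mem_blockSpace hs).trans_eq (by simp)
  intro x hx hx'
  obtain ⟨u, w, rfl⟩ := mem_blockSpace.1 hx
  obtain ⟨u', w', hu⟩ := mem_blockSpace.1 hx'
  rw [Prod.mk.injEq] at hu
  obtain rfl : u = u' := Subtype.ext hu.1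
  have h1 : σ ((κ - κ') * e u) = w' - w := by
    rw [sub_mul, map_sub, sub_eq_sub_iff_add_eq_add, add_comm, hu.2]
  have h2 := hσ _ (h1 ▸ W.sub_mem w'.2 w.2)
  have h3 : u = 0 := by simpa [sub_eq_zero, h] using h2
  simp [h3]

end

/-- Coset construction. The lines of a `4`-dimensional space `A` in a family `ℓ` are divided
into classes `ℓ i`, lines in one class being pairwise skew. Adding to the graphs of a rank metric
code and to `0 × A` the blocks with projection and intersection in a common class gives a code in
`A × A`: of two such blocks, either the projections or the intersections are skew lines if their
classes agree and the two pairs of lines differ, and both pairs meet in at most a point if their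
classes differ. -/
theorem code_of_parallelism {F : Type*} [Field F] [Finite F] {A : Type*} [AddCommGroup A]
    [Module F A] (hA : finrank F A = 4) {I : Type*} [Finite I] {J : I → Type*} [∀ i, Finite (J i)]
    (ℓ : ∀ i, J i → Submodule F A) (hℓ : ∀ i j, finrank F (ℓ i j) = 2)
    (hskew : ∀ i j j', j ≠ j' → ℓ i j ⊓ ℓ i j' = ⊥)
    (hclass : ∀ i i' j j', i ≠ i' → ℓ i j ≠ ℓ i' j') :
    Nat.card F ^ 12 + Nat.card (Σ i, J i × J i) * Nat.card F ^ 2 + 1 ≤ maxCodeSize F 8 4 4 := by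
  classical
  have : FiniteDimensional F A := FiniteDimensional.of_finrank_eq_succ hA
  obtain ⟨p, hp⟩ := CharP.exists F
  have hprime : Fact p.Prime := ⟨CharP.char_is_prime F p⟩
  let K := FiniteField.Extension F p 2
  have hK : finrank F K = 2 := FiniteField.finrank_extension F p 2
  have hcardK : Nat.card K = Nat.card F ^ 2 := FiniteField.natCard_extension F p 2
  have hfK : Finite K := Module.finite_of_finite F
  obtain ⟨N, hN, hN2⟩ := exists_homCode (F := F) hA hA (by norm_num) le_rfl
  have hfin : Finite (A →ₗ[F] A) := Module.finite_of_finite F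
  let e (i) (j : J i) : ℓ i j ≃ₗ[F] K := LinearEquiv.ofFinrankEq _ _ ((hℓ i j).trans hK.symm)
  have hσ (i) (j : J i) : ∃ σ : K →ₗ[F] A, ∀ k, σ k ∈ ℓ i j → k = 0 := by
    obtain ⟨C, hC⟩ := Submodule.exists_isCompl (ℓ i j)
    have hC2 : finrank F C = 2 := by
      have := Submodule.finrank_add_eq_of_isCompl hC
      rw [hℓ, hA] at this
      omega
    let f : K ≃ₗ[F] C := LinearEquiv.ofFinrankEq _ _ (hK.trans hC2.symm)
    refine ⟨C.subtype ∘ₗ f.toLinearMap, fun k hk => ?_⟩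
    have h0 : (f k : A) = 0 := by
      have : (f k : A) ∈ ℓ i j ⊓ C := ⟨hk, (f k).2⟩
      rwa [hC.inf_eq_bot, Submodule.mem_bot] at this
    exact f.map_eq_zero_iff.1 (Subtype.ext h0)
  choose σ hσ using hσ
  let B (x : Σ i, (J i × J i) × K) : Submodule F (A × A) :=
    blockSpace (ℓ x.1 x.2.1.1) (ℓ x.1 x.2.1.2) (e x.1 x.2.1.1) (σ x.1 x.2.1.2) x.2.2
  let V : Submodule F (A × A) := LinearMap.range (LinearMap.inr F A A)
  have hV (x : A × A) (hx : x ∈ V) : x.1 = 0 := by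
    obtain ⟨s, rfl⟩ := hx
    rfl
  have hgraph (φ : A →ₗ[F] A) (s : A) (hs : ((0 : A), s) ∈ φ.graph) : s = 0 := by
    rw [LinearMap.mem_graph_iff, map_zero] at hs
    exact hs
  -- Two lines of different classes share at most a point.
  have hmeet (i i') (j : J i) (j' : J i') (h : i ≠ i') : finrank F ↥(ℓ i j ⊓ ℓ i' j') ≤ 1 := by
    have hlt : ℓ i j ⊓ ℓ i' j' < ℓ i j := by
      refine lt_of_le_of_ne inf_le_left fun heq => hclass i i' j j' h ?_
      exact Submodule.eq_of_le_of_finrank_eq (inf_eq_left.1 heq) (by rw [hℓ, hℓ])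
    have := Submodule.finrank_lt_finrank_of_lt hlt
    rw [hℓ] at this
    omega
  have hBB (x y) (hxy : x ≠ y) : finrank F ↥(B x ⊓ B y) ≤ 2 := by
    have hle : finrank F ↥(B x ⊓ B y) ≤ finrank F ↥(ℓ x.1 x.2.1.1 ⊓ ℓ y.1 y.2.1.1) +
        finrank F ↥(ℓ x.1 x.2.1.2 ⊓ ℓ y.1 y.2.1.2) :=
      finrank_inf_le_add
        (fun z hz hz' => ⟨fst_mem_of_mem_blockSpace hz, fst_mem_of_mem_blockSpace hz'⟩)
        fun s hs hs' => ⟨mem_of_inr_mem_blockSpace hs, mem_of_inr_mem_blockSpace hs'⟩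
    obtain ⟨i, ⟨j, k⟩, κ⟩ := x
    obtain ⟨i', ⟨j', k'⟩, κ'⟩ := y
    by_cases hi : i = i'
    · subst hi
      have h2 (a b : J i) : finrank F ↥(ℓ i a ⊓ ℓ i b) ≤ 2 :=
        (Submodule.finrank_mono inf_le_left).trans_eq (hℓ i a)
      by_cases hj : j = j'
      · by_cases hk : k = k'
        · subst hj hk
          exact (finrank_blockSpace_inf_le (hσ i k) (by rintro rfl; exact hxy rfl)).trans_eq
            (hℓ i k)
        · have h0 : finrank F ↥(ℓ i k ⊓ ℓ i k') = 0 := by rw [hskew i k k' hk, finrank_bot]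
          exact hle.trans (Nat.add_le_add (h2 j j') h0.le)
      · have h0 : finrank F ↥(ℓ i j ⊓ ℓ i j') = 0 := by rw [hskew i j j' hj, finrank_bot]
        exact (hle.trans (Nat.add_le_add h0.le (h2 k k'))).trans_eq (zero_add 2)
    · exact hle.trans (Nat.add_le_add (hmeet _ _ _ _ hi) (hmeet _ _ _ _ hi))
  have hNB (φ : A →ₗ[F] A) (x) : finrank F ↥(φ.graph ⊓ B x) ≤ 2 := by
    refine (finrank_inf_le_add (Y := ℓ x.1 x.2.1.1) (Z := ⊥)
      (fun z _ hz => fst_mem_of_mem_blockSpace hz) fun s hs _ => hgraph φ s hs).trans ?_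
    rw [finrank_bot, hℓ]
  have hNV (φ : A →ₗ[F] A) : finrank F ↥(φ.graph ⊓ V) ≤ 2 := by
    refine (finrank_inf_le_add (Y := ⊥) (Z := ⊥) (fun z _ hz => hV z hz)
      fun s hs _ => hgraph φ s hs).trans ?_
    simp
  have hBV (x) : finrank F ↥(B x ⊓ V) ≤ 2 := by
    refine (finrank_inf_le_add (Y := ⊥) (Z := ℓ x.1 x.2.1.2) (fun z _ hz => hV z hz)
      fun s hs _ => mem_of_inr_mem_blockSpace hs).trans ?_
    rw [finrank_bot, hℓ]
  have hNN (φ ψ : N) (h : φ ≠ ψ) : finrank F ↥(φ.1.graph ⊓ ψ.1.graph) ≤ 2 := by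
    refine (finrank_inf_le_add (Y := LinearMap.ker (φ.1 - ψ.1)) (Z := ⊥) ?_
      fun s hs _ => hgraph _ s hs).trans ?_
    · intro z hz hz'
      have h1 := (LinearMap.mem_graph_iff _ _).1 hz
      have h2 := (LinearMap.mem_graph_iff _ _).1 hz'
      rw [LinearMap.mem_ker, LinearMap.sub_apply, ← h1, ← h2, sub_self]
    · have h1 := hN2 _ (N.sub_mem φ.2 ψ.2) (sub_ne_zero.2 fun h' => h (Subtype.ext h'))
      have h2 := LinearMap.finrank_range_add_finrank_ker (φ.1 - ψ.1)
      rw [hA] at h2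
      rw [finrank_bot]
      omega
  let U : Option (N ⊕ Σ i, (J i × J i) × K) → Submodule F (A × A) :=
    fun x => x.elim V (Sum.elim (fun φ => φ.1.graph) B)
  have hU := card_le_maxCodeSize (n := 8) (by rw [finrank_prod, hA]) U ?_ ?_
  · refine le_trans ?_ hU
    have e1 : (Σ i, (J i × J i) × K) ≃ (Σ i, J i × J i) × K :=
      { toFun := fun x => (⟨x.1, x.2.1⟩, x.2.2)
        invFun := fun x => ⟨x.1.1, x.1.2, x.2⟩
        left_inv := fun _ => rfl
        right_inv := fun _ => rfl }
    rw [Finite.card_option, Nat.card_sum, Nat.card_congr e1, Nat.card_prod, hcardK]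
    exact Nat.add_le_add_right (Nat.add_le_add_right hN _) _
  · rintro (_ | φ | x)
    · exact (LinearMap.finrank_range_of_inj LinearMap.inr_injective).trans hA
    · exact (finrank_graph _).trans hA
    · exact (finrank_blockSpace _ _ _ _ _).trans (by rw [hℓ, hℓ])
  · rintro (_ | φ | x) (_ | ψ | y) hne
    · exact absurd rfl hne
    · rw [inf_comm]; exact hNV _
    · rw [inf_comm]; exact hBV _
    · exact hNV _
    · exact hNN φ ψ fun h => hne (by rw [h])
    · exact hNB _ _
    · exact hBV _
    · rw [inf_comm]; exact hNB _ _
    · exact hBB x y fun h => hne (by rw [h])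

/-! ### Parallelisms of projective three-space -/

section

variable {F K : Type*} [Field F] [Field K] [Algebra F K]

theorem exists_basis_of_notMem_range (hK : finrank F K = 2) {θ : K}
    (hθ : θ ∉ Set.range (algebraMap F K)) : ∃ b : Basis (Fin 2) F K, b 0 = 1 ∧ b 1 = θ := by
  have hli : LinearIndependent F ![(1 : K), θ] := by
    rw [LinearIndependent.pair_iff]
    intro s t h
    have ht : t = 0 := by
      by_contra ht
      refine hθ ⟨-s / t, ?_⟩
      have ht' : algebraMap F K t ≠ 0 := (map_ne_zero _).2 ht
      rw [map_div₀, map_neg, div_eq_iff ht']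
      rw [Algebra.smul_def, Algebra.smul_def, mul_one] at h
      linear_combination -h
    rw [ht, zero_smul, add_zero, smul_eq_zero] at h
    exact ⟨h.resolve_right one_ne_zero, ht⟩
  refine ⟨basisOfLinearIndependentOfCardEqFinrank hli (by simp [hK]), ?_, ?_⟩ <;> simp

/-- If `F` has at least three elements then its quadratic extension `K` has an `F`-linear
endomorphism which has no eigenvector and is not the multiplication by an element of `K`.
It is conjugate to the multiplication by some `θ` under a linear map with `1 ↦ 1` and `θ ↦ θ'`,
where `θ'` lies outside `F` and is not a root of the minimal polynomial of `θ`. -/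
theorem exists_twisted_end [Finite F] (hK : finrank F K = 2) (hq : 3 ≤ Nat.card F) :
    ∃ h : K →ₗ[F] K, (∀ (s : F) (x : K), h x = s • x → x = 0) ∧
      ∀ η : K, ¬ ∀ x, h x = η * x := by
  classical
  have hfd : FiniteDimensional F K := FiniteDimensional.of_finrank_eq_succ hK
  have hfin : Finite K := Module.finite_of_finite F
  have := Fintype.ofFinite K
  have := Fintype.ofFinite F
  have hcard : Fintype.card K = Fintype.card F ^ 2 := by
    have := Module.natCard_eq_pow_finrank (K := F) (V := K)
    rwa [hK, Nat.card_eq_fintype_card, Nat.card_eq_fintype_card] at this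
  rw [Nat.card_eq_fintype_card] at hq
  have hout (T : Finset K) (hT : T.card ≤ 2) : ∃ θ ∉ Set.range (algebraMap F K), θ ∉ T := by
    by_contra hcon
    push Not at hcon
    have h1 : (Finset.univ : Finset K) ⊆ Finset.univ.image (algebraMap F K) ∪ T := by
      intro x _
      by_cases hx : x ∈ Set.range (algebraMap F K)
      · obtain ⟨a, rfl⟩ := hx
        simp
      · exact Finset.mem_union_right _ (hcon x hx)
    have h2 := (Finset.card_le_card h1).trans (Finset.card_union_le _ _)
    have h3 : (Finset.univ.image (algebraMap F K)).card ≤ Fintype.card F := Finset.card_image_le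
    rw [Finset.card_univ, hcard] at h2
    nlinarith
  obtain ⟨θ, hθ, -⟩ := hout ∅ (by simp)
  obtain ⟨b, hb0, hb1⟩ := exists_basis_of_notMem_range hK hθ
  set v := b.repr (θ * θ) 0
  set u := b.repr (θ * θ) 1
  have hθθ : θ * θ = v • (1 : K) + u • θ := by
    rw [← b.sum_repr (θ * θ), Fin.sum_univ_two, hb0, hb1]
  obtain ⟨θ', hθ', hT⟩ := hout {θ, algebraMap F K u - θ} Finset.card_le_two
  obtain ⟨b', hb'0, hb'1⟩ := exists_basis_of_notMem_range hK hθ'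
  let A : K ≃ₗ[F] K := b.equiv b' (Equiv.refl _)
  have hA1 : A 1 = 1 := by
    have := b.equiv_apply 0 b' (Equiv.refl _)
    rwa [Equiv.refl_apply, hb0, hb'0] at this
  have hAθ : A θ = θ' := by
    have := b.equiv_apply 1 b' (Equiv.refl _)
    rwa [Equiv.refl_apply, hb1, hb'1] at this
  refine ⟨A.toLinearMap ∘ₗ LinearMap.mulLeft F θ ∘ₗ A.symm.toLinearMap, ?_, ?_⟩
  · intro s x hx
    have h1 : θ * A.symm x = s • A.symm x := by
      rw [← map_smul, ← hx]
      simp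
    by_contra hx0
    have h2 : A.symm x ≠ 0 := fun h => hx0 (A.symm.map_eq_zero_iff.1 h)
    rw [Algebra.smul_def] at h1
    exact hθ ⟨s, (mul_right_cancel₀ h2 h1).symm⟩
  · intro η hη
    have hη' (y : K) : A (θ * y) = η * A y := by
      have := hη (A y)
      simpa using this
    have h1 := hη' 1
    rw [mul_one, hA1, mul_one, hAθ] at h1
    have h2 := hη' θ
    rw [hθθ, map_add, map_smul, map_smul, hA1, hAθ, ← h1, Algebra.smul_def, Algebra.smul_def,
      mul_one] at h2
    rw [Algebra.smul_def, Algebra.smul_def, mul_one] at hθθ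
    have h3 : (θ' - θ) * (θ' - (algebraMap F K u - θ)) = 0 := by
      linear_combination -hθθ - h2
    rw [mul_eq_zero, sub_eq_zero, sub_eq_zero] at h3
    exact hT (by simpa using h3)

/-- The `2`-dimensional subspace of `K × K` spanned by `(x, y)` and `(0, z)`. -/
def pairLine (F : Type*) {K : Type*} [Field F] [Field K] [Algebra F K] (x y z : K) :
    Submodule F (K × K) :=
  LinearMap.range ((LinearMap.toSpanSingleton F (K × K) (x, y)).coprod
    (LinearMap.toSpanSingleton F (K × K) (0, z)))

theorem mem_pairLine {x y z : K} {w : K × K} :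
    w ∈ pairLine F x y z ↔ ∃ a b : F, w = (a • x, a • y + b • z) := by
  unfold pairLine
  rw [LinearMap.mem_range, Prod.exists]
  refine exists_congr fun a => exists_congr fun b => ?_
  rw [eq_comm]
  simp

theorem finrank_pairLine {x y z : K} (hx : x ≠ 0) (hz : z ≠ 0) :
    finrank F (pairLine F x y z) = 2 := by
  unfold pairLine
  rw [LinearMap.finrank_range_of_inj, finrank_prod, finrank_self]
  rw [← LinearMap.ker_eq_bot, LinearMap.ker_eq_bot']
  rintro ⟨a, b⟩ h
  simp only [LinearMap.coprod_apply, LinearMap.toSpanSingleton_apply, Prod.smul_mk, smul_zero,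
    Prod.mk_add_mk, add_zero, Prod.mk_eq_zero, smul_eq_zero, hx, or_false] at h
  obtain ⟨rfl, h⟩ := h
  rw [zero_smul, zero_add, smul_eq_zero] at h
  rw [h.resolve_right hz, Prod.mk_zero_zero]

theorem pairLine_ne_graph {x y z : K} (hz : z ≠ 0) (f : K →ₗ[F] K) :
    pairLine F x y z ≠ f.graph := by
  intro h
  have h1 : ((0 : K), z) ∈ f.graph := h ▸ mem_pairLine.2 ⟨0, 1, by simp⟩
  rw [LinearMap.mem_graph_iff, map_zero] at h1
  exact hz h1

theorem apply_eq_of_graph_eq {f g : K →ₗ[F] K} (h : f.graph = g.graph) (x : K) : f x = g x := by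
  have h1 : (x, f x) ∈ g.graph := by
    rw [← h, LinearMap.mem_graph_iff]
  exact (LinearMap.mem_graph_iff _ _).1 h1

theorem smul_rep_eq_smul_rep {p p' : ℙ F K} (hp : p ≠ p') {a b : F}
    (h : a • p.rep = b • p'.rep) : a = 0 ∧ b = 0 := by
  have ha : a = 0 := by
    by_contra ha
    refine hp ?_
    rw [← p.mk_rep, ← p'.mk_rep, Projectivization.mk_eq_mk_iff']
    refine ⟨a⁻¹ * b, ?_⟩
    rw [mul_smul, ← h, smul_smul, inv_mul_cancel₀ ha, one_smul]
  refine ⟨ha, ?_⟩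
  rw [ha, zero_smul, eq_comm, smul_eq_zero] at h
  exact h.resolve_right p'.rep_nonzero

/-- The point `p` is determined by the line, `z` up to a scalar, and `y` modulo multiples of `z`. -/
theorem pairLine_eq {p p' : ℙ F K} {y y' z z' : K}
    (h : pairLine F p.rep y z = pairLine F p'.rep y' z') :
    p = p' ∧ (∃ a : F, z = a • z') ∧ ∃ a : F, y = y' + a • z' := by
  have h1 : (p.rep, y) ∈ pairLine F p'.rep y' z' := h ▸ mem_pairLine.2 ⟨1, 0, by simp⟩
  have h2 : ((0 : K), z) ∈ pairLine F p'.rep y' z' := h ▸ mem_pairLine.2 ⟨0, 1, by simp⟩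
  obtain ⟨a, b, hab⟩ := mem_pairLine.1 h1
  obtain ⟨c, d, hcd⟩ := mem_pairLine.1 h2
  rw [Prod.mk.injEq] at hab hcd
  have hpp : p = p' := by
    by_contra hne
    exact one_ne_zero (smul_rep_eq_smul_rep hne (a := (1 : F)) (by rw [one_smul]; exact hab.1)).1
  subst hpp
  have ha : a = 1 := by
    have : (a - 1) • p.rep = 0 := by rw [sub_smul, one_smul, ← hab.1, sub_self]
    rw [smul_eq_zero, sub_eq_zero] at this
    exact this.resolve_right p.rep_nonzero
  have hc : c = 0 := (smul_eq_zero.1 hcd.1.symm).resolve_right p.rep_nonzero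
  refine ⟨rfl, ⟨d, ?_⟩, b, ?_⟩
  · rw [hcd.2, hc, zero_smul, zero_add]
  · rw [hab.2, ha, one_smul]

/-- The map `x ↦ d (κ x + h x)`. -/
def twistedMap (h : K →ₗ[F] K) (d κ : K) : K →ₗ[F] K :=
  LinearMap.mulLeft F d ∘ₗ (LinearMap.mulLeft F κ + h)

theorem twistedMap_apply (h : K →ₗ[F] K) (d κ x : K) : twistedMap h d κ x = d * (κ * x + h x) := rfl

/-- The classes of the parallelism: one regular spread, one for each nonzero element of `K`,
and one for each point of the projective line `ℙ F K`. -/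
abbrev ClassIndex (F K : Type*) [Field F] [Field K] [Algebra F K] : Type _ :=
  Option (Kˣ ⊕ ℙ F K)

/-- The pairs of a nonzero and an arbitrary element of `F`, as elements of `K × K`. -/
abbrev scalarPairs (F K : Type*) [Field F] [Field K] [Algebra F K] : Set (K × K) :=
  Set.range fun ts : Fˣ × F => (algebraMap F K ts.1, algebraMap F K ts.2)

/-- The lines of a class. -/
abbrev LineIndex (F K : Type*) [Field F] [Field K] [Algebra F K] : ClassIndex F K → Type _
  | none => Option K
  | some (Sum.inl _) => {κ : K // κ ∉ Set.range (algebraMap F K)} ⊕ ℙ F K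
  | some (Sum.inr _) => scalarPairs F K ⊕ ℙ F K

/-- The lines of a parallelism. The first class consists of the `K`-subspaces of dimension one.
The class of `d` is the regular spread of `0 × K` and the graphs of `x ↦ d (κ x + h x)`, with the
regulus formed by `0 × K` and the graphs with `κ ∈ F` replaced by its opposite regulus. The class of
a point `p`, represented by `d`, is the regular spread of `0 × K` and the graphs of
`x ↦ d (s x + t h x)`, `s, t ∈ F`, with the regulus `t = 0` replaced by its opposite regulus; for
`t ≠ 0` these maps are written as `x ↦ t d (s x + h x)`. -/
noncomputable def parallelLine (h : K →ₗ[F] K) :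
    ∀ i : ClassIndex F K, LineIndex F K i → Submodule F (K × K)
  | none, none => LinearMap.range (LinearMap.inr F K K)
  | none, some a => (LinearMap.mulLeft F a).graph
  | some (Sum.inl d), Sum.inl κ => (twistedMap h d κ.1).graph
  | some (Sum.inl d), Sum.inr x => pairLine F x.rep (d * h x.rep) (d * x.rep)
  | some (Sum.inr p), Sum.inl ts => (twistedMap h (ts.1.1 * p.rep) ts.1.2).graph
  | some (Sum.inr p), Sum.inr x => pairLine F x.rep 0 (p.rep * x.rep)

theorem finrank_parallelLine (hK : finrank F K = 2) (h : K →ₗ[F] K) (i : ClassIndex F K)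
    (j : LineIndex F K i) : finrank F (parallelLine h i j) = 2 := by
  match i, j with
  | none, none => exact (LinearMap.finrank_range_of_inj LinearMap.inr_injective).trans hK
  | none, some a => exact (finrank_graph _).trans hK
  | some (Sum.inl d), Sum.inl κ => exact (finrank_graph _).trans hK
  | some (Sum.inl d), Sum.inr x =>
    exact finrank_pairLine x.rep_nonzero (mul_ne_zero d.ne_zero x.rep_nonzero)
  | some (Sum.inr p), Sum.inl ts => exact (finrank_graph _).trans hK
  | some (Sum.inr p), Sum.inr x =>
    exact finrank_pairLine x.rep_nonzero (mul_ne_zero p.rep_nonzero x.rep_nonzero)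

theorem pairLine_inf_eq_bot {p p' : ℙ F K} (hp : p ≠ p') {y y' d : K} (hd : d ≠ 0) :
    pairLine F p.rep y (d * p.rep) ⊓ pairLine F p'.rep y' (d * p'.rep) = ⊥ := by
  rw [Submodule.eq_bot_iff]
  rintro w ⟨hw, hw'⟩
  obtain ⟨a, b, rfl⟩ := mem_pairLine.1 hw
  obtain ⟨a', b', hab⟩ := mem_pairLine.1 hw'
  rw [Prod.mk.injEq] at hab
  obtain ⟨rfl, rfl⟩ := smul_rep_eq_smul_rep hp hab.1
  have h2 := hab.2
  rw [zero_smul, zero_smul, zero_add, zero_add, ← mul_smul_comm, ← mul_smul_comm] at h2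
  obtain ⟨rfl, rfl⟩ := smul_rep_eq_smul_rep hp (mul_left_cancel₀ hd h2)
  simp

variable {h : K →ₗ[F] K}

theorem eq_zero_of_smul_add_smul (hh : ∀ (s : F) (x : K), h x = s • x → x = 0) {a b : F} {x : K}
    (hab : a • h x = b • x) (hx : x ≠ 0) : a = 0 ∧ b = 0 := by
  have ha : a = 0 := by
    by_contra ha
    refine hx (hh (a⁻¹ * b) x ?_)
    rw [mul_smul, ← hab, smul_smul, inv_mul_cancel₀ ha, one_smul]
  refine ⟨ha, ?_⟩
  rw [ha, zero_smul, eq_comm, smul_eq_zero] at hab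
  exact hab.resolve_right hx

theorem graph_inf_eq_bot {f g : K →ₗ[F] K} (hfg : ∀ x, f x = g x → x = 0) :
    f.graph ⊓ g.graph = ⊥ := by
  rw [Submodule.eq_bot_iff]
  rintro ⟨x, y⟩ ⟨hw, hw'⟩
  rw [SetLike.mem_coe, LinearMap.mem_graph_iff] at hw hw'
  simp only at hw hw'
  have := hfg x (hw.symm.trans hw')
  rw [hw, this, map_zero, Prod.mk_zero_zero]

theorem graph_inf_pairLine_eq_bot {f : K →ₗ[F] K} {x y z : K}
    (hf : ∀ a b : F, a • y + b • z = a • f x → a = 0 ∧ b = 0) :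
    f.graph ⊓ pairLine F x y z = ⊥ := by
  rw [Submodule.eq_bot_iff]
  rintro w ⟨hw, hw'⟩
  obtain ⟨a, b, rfl⟩ := mem_pairLine.1 hw'
  rw [SetLike.mem_coe, LinearMap.mem_graph_iff, map_smul] at hw
  obtain ⟨rfl, rfl⟩ := hf a b hw
  simp

theorem parallelLine_inf_eq_bot (hh : ∀ (s : F) (x : K), h x = s • x → x = 0)
    (i : ClassIndex F K) (j j' : LineIndex F K i) (hj : j ≠ j') :
    parallelLine h i j ⊓ parallelLine h i j' = ⊥ := by
  have hinf (a : K) : (LinearMap.mulLeft F a).graph ⊓ LinearMap.range (LinearMap.inr F K K) = ⊥ := by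
    rw [Submodule.eq_bot_iff]
    rintro w ⟨hw, s, rfl⟩
    rw [SetLike.mem_coe, LinearMap.mem_graph_iff] at hw
    have : s = 0 := by simpa using hw
    rw [this, map_zero]
  have hinl (d : Kˣ) (κ : {κ : K // κ ∉ Set.range (algebraMap F K)}) (x : ℙ F K) :
      (twistedMap h d κ.1).graph ⊓ pairLine F x.rep (d * h x.rep) (d * x.rep) = ⊥ := by
    refine graph_inf_pairLine_eq_bot fun a b hab => ?_
    rw [twistedMap_apply, Algebra.smul_def, Algebra.smul_def, Algebra.smul_def] at hab
    have h1 : (d : K) * x.rep * (algebraMap F K b - algebraMap F K a * κ) = 0 := by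
      linear_combination hab
    have h2 := (mul_eq_zero.1 h1).resolve_left (mul_ne_zero d.ne_zero x.rep_nonzero)
    have ha : a = 0 := by
      by_contra ha
      refine κ.2 ⟨b / a, ?_⟩
      rw [map_div₀, div_eq_iff ((map_ne_zero _).2 ha)]
      linear_combination h2
    rw [ha, map_zero, zero_mul, sub_zero, map_eq_zero] at h2
    exact ⟨ha, h2⟩
  have hinr (p : ℙ F K) (t : Fˣ) (s : F) (x : ℙ F K) :
      (twistedMap h (algebraMap F K t * p.rep) (algebraMap F K s)).graph ⊓
        pairLine F x.rep 0 (p.rep * x.rep) = ⊥ := by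
    refine graph_inf_pairLine_eq_bot fun a b hab => ?_
    rw [twistedMap_apply, smul_zero, zero_add] at hab
    have h1 : (a * t) • h x.rep = (b - a * t * s) • x.rep := by
      refine mul_left_cancel₀ p.rep_nonzero ?_
      simp only [Algebra.smul_def, map_mul, map_sub] at hab ⊢
      linear_combination -hab
    obtain ⟨h2, h3⟩ := eq_zero_of_smul_add_smul hh h1 x.rep_nonzero
    have ha := (mul_eq_zero.1 h2).resolve_right t.ne_zero
    refine ⟨ha, ?_⟩
    rwa [ha, zero_mul, zero_mul, sub_zero] at h3
  match i, j, j' with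
  | none, none, none => exact absurd rfl hj
  | none, none, some a => rw [inf_comm]; exact hinf a
  | none, some a, none => exact hinf a
  | none, some a, some b =>
    refine graph_inf_eq_bot fun x hx => ?_
    have hab : a ≠ b := fun h => hj (by rw [h])
    simpa [hab] using hx
  | some (Sum.inl d), Sum.inl κ, Sum.inl κ' =>
    refine graph_inf_eq_bot fun x hx => ?_
    have hκ : κ.1 - κ'.1 ≠ 0 := sub_ne_zero.2 fun h => hj (by rw [Subtype.ext h])
    rw [twistedMap_apply, twistedMap_apply] at hx
    have := mul_left_cancel₀ d.ne_zero hx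
    refine (mul_eq_zero.1 ?_).resolve_left hκ
    linear_combination this
  | some (Sum.inl d), Sum.inl κ, Sum.inr x => exact hinl d κ x
  | some (Sum.inl d), Sum.inr x, Sum.inl κ => rw [inf_comm]; exact hinl d κ x
  | some (Sum.inl d), Sum.inr x, Sum.inr x' =>
    exact pairLine_inf_eq_bot (fun h => hj (by rw [h])) d.ne_zero
  | some (Sum.inr p), Sum.inl ⟨_, (t, s), rfl⟩, Sum.inl ⟨_, (t', s'), rfl⟩ =>
    refine graph_inf_eq_bot fun x hx => ?_
    rw [twistedMap_apply, twistedMap_apply] at hx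
    by_contra hx0
    have h1 : ((t : F) - t') • h x = (t' * s' - t * s) • x := by
      refine mul_left_cancel₀ p.rep_nonzero ?_
      simp only [Algebra.smul_def, map_mul, map_sub] at hx ⊢
      linear_combination hx
    obtain ⟨h2, h3⟩ := eq_zero_of_smul_add_smul hh h1 hx0
    have ht : t = t' := Units.ext (sub_eq_zero.1 h2)
    rw [ht, ← mul_sub] at h3
    have hs := sub_eq_zero.1 ((mul_eq_zero.1 h3).resolve_left t'.ne_zero)
    exact hj (by rw [ht, hs])
  | some (Sum.inr p), Sum.inl ⟨_, (t, s), rfl⟩, Sum.inr x => exact hinr p t s x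
  | some (Sum.inr p), Sum.inr x, Sum.inl ⟨_, (t, s), rfl⟩ => rw [inf_comm]; exact hinr p t s x
  | some (Sum.inr p), Sum.inr x, Sum.inr x' =>
    exact pairLine_inf_eq_bot (fun h => hj (by rw [h])) p.rep_nonzero

theorem parallelLine_ne (hh : ∀ (s : F) (x : K), h x = s • x → x = 0)
    (hη : ∀ η : K, ¬ ∀ x, h x = η * x) (i i' : ClassIndex F K) (j : LineIndex F K i)
    (j' : LineIndex F K i') (hi : i ≠ i') : parallelLine h i j ≠ parallelLine h i' j' := by
  have hz {d : K} (hd : d ≠ 0) (x : ℙ F K) : d * x.rep ≠ 0 := mul_ne_zero hd x.rep_nonzero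
  have hlin {d κ a : K} (hd : d ≠ 0) :
      (twistedMap h d κ).graph ≠ (LinearMap.mulLeft F a).graph := by
    intro heq
    refine hη (a / d - κ) fun x => ?_
    have := apply_eq_of_graph_eq heq x
    rw [twistedMap_apply, LinearMap.mulLeft_apply] at this
    field_simp
    linear_combination this
  have htw {d d' κ κ' : K} (heq : (twistedMap h d κ).graph = (twistedMap h d' κ').graph)
      (hd' : d' ≠ 0) : d = d' ∧ κ = κ' := by
    have h1 (x : K) : (d - d') * h x = (d' * κ' - d * κ) * x := by
      have := apply_eq_of_graph_eq heq x
      rw [twistedMap_apply, twistedMap_apply] at this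
      linear_combination this
    have hd : d = d' := by
      by_contra hne
      refine hη ((d' * κ' - d * κ) / (d - d')) fun x => ?_
      have := sub_ne_zero.2 hne
      rw [div_mul_eq_mul_div, ← h1, mul_div_cancel_left₀ _ this]
    refine ⟨hd, ?_⟩
    have h2 := h1 1
    rw [hd, sub_self, zero_mul, mul_one, ← mul_sub, eq_comm, mul_eq_zero, sub_eq_zero] at h2
    exact (h2.resolve_left hd').symm
  have hgv (f : K →ₗ[F] K) : f.graph ≠ LinearMap.range (LinearMap.inr F K K) := by
    intro heq
    have h1 : ((0 : K), (1 : K)) ∈ f.graph := heq ▸ ⟨1, rfl⟩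
    rw [LinearMap.mem_graph_iff, map_zero] at h1
    exact one_ne_zero h1
  have hpv {x y z : K} (hx : x ≠ 0) : pairLine F x y z ≠ LinearMap.range (LinearMap.inr F K K) := by
    intro heq
    have h1 : (x, y) ∈ LinearMap.range (LinearMap.inr F K K) :=
      heq ▸ mem_pairLine.2 ⟨1, 0, by simp⟩
    obtain ⟨s, hs⟩ := h1
    exact hx (congrArg Prod.fst hs).symm
  have ht {t : Fˣ} (p : ℙ F K) : algebraMap F K t * p.rep ≠ 0 :=
    mul_ne_zero ((map_ne_zero _).2 t.ne_zero) p.rep_nonzero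
  have hreg (d : Kˣ) (j' : LineIndex F K none) (j : LineIndex F K (some (Sum.inl d))) :
      parallelLine h _ j ≠ parallelLine h _ j' := by
    match j, j' with
    | Sum.inl κ, none => exact hgv _
    | Sum.inr x, none => exact hpv x.rep_nonzero
    | Sum.inl κ, some a => exact hlin d.ne_zero
    | Sum.inr x, some a => exact pairLine_ne_graph (hz d.ne_zero x) _
  have hreg' (p : ℙ F K) (j' : LineIndex F K none) (j : LineIndex F K (some (Sum.inr p))) :
      parallelLine h _ j ≠ parallelLine h _ j' := by
    match j, j' with
    | Sum.inl ts, none => exact hgv _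
    | Sum.inr x, none => exact hpv x.rep_nonzero
    | Sum.inl ⟨_, (t, s), rfl⟩, some a => exact hlin (ht p)
    | Sum.inr x, some a => exact pairLine_ne_graph (hz p.rep_nonzero x) _
  have hmix (d : Kˣ) (p : ℙ F K) (j : LineIndex F K (some (Sum.inl d)))
      (j' : LineIndex F K (some (Sum.inr p))) : parallelLine h _ j ≠ parallelLine h _ j' := by
    match j, j' with
    | Sum.inl κ, Sum.inl ⟨_, (t, s), rfl⟩ =>
      intro heq
      exact κ.2 ⟨s, (htw heq (ht p)).2.symm⟩
    | Sum.inl κ, Sum.inr x => exact (pairLine_ne_graph (hz p.rep_nonzero x) _).symm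
    | Sum.inr x, Sum.inl ts => exact pairLine_ne_graph (hz d.ne_zero x) _
    | Sum.inr x, Sum.inr x' =>
      intro heq
      obtain ⟨rfl, ⟨a, ha⟩, b, hb⟩ := pairLine_eq heq
      rw [← smul_mul_assoc] at ha
      have hd := mul_right_cancel₀ x.rep_nonzero ha
      have h1 : a • h x.rep = b • x.rep := by
        refine mul_left_cancel₀ p.rep_nonzero ?_
        rw [hd, zero_add] at hb
        simp only [Algebra.smul_def] at hb ⊢
        linear_combination hb
      obtain ⟨ha0, -⟩ := eq_zero_of_smul_add_smul hh h1 x.rep_nonzero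
      rw [ha0, zero_smul] at hd
      exact d.ne_zero hd
  match i, i' with
  | none, none => exact absurd rfl hi
  | none, some (Sum.inl d) => exact (hreg d j j').symm
  | none, some (Sum.inr p) => exact (hreg' p j j').symm
  | some (Sum.inl d), none => exact hreg d j' j
  | some (Sum.inr p), none => exact hreg' p j' j
  | some (Sum.inl d), some (Sum.inr p) => exact hmix d p j j'
  | some (Sum.inr p), some (Sum.inl d) => exact (hmix d p j' j).symm
  | some (Sum.inl d), some (Sum.inl d') =>
    have hd : (d : K) ≠ d' := fun h => hi (by rw [Units.ext h])
    match j, j' with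
    | Sum.inl κ, Sum.inl κ' => exact fun heq => hd (htw heq d'.ne_zero).1
    | Sum.inl κ, Sum.inr x => exact (pairLine_ne_graph (hz d'.ne_zero x) _).symm
    | Sum.inr x, Sum.inl κ => exact pairLine_ne_graph (hz d.ne_zero x) _
    | Sum.inr x, Sum.inr x' =>
      intro heq
      obtain ⟨rfl, ⟨a, ha⟩, b, hb⟩ := pairLine_eq heq
      rw [← smul_mul_assoc] at ha
      have hda := mul_right_cancel₀ x.rep_nonzero ha
      have h1 : (a - 1) • h x.rep = b • x.rep := by
        refine mul_left_cancel₀ d'.ne_zero ?_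
        rw [hda] at hb
        simp only [Algebra.smul_def, map_sub, map_one] at hb ⊢
        linear_combination hb
      obtain ⟨ha0, -⟩ := eq_zero_of_smul_add_smul hh h1 x.rep_nonzero
      rw [sub_eq_zero.1 ha0, one_smul] at hda
      exact hd hda
  | some (Sum.inr p), some (Sum.inr p') =>
    have hp : p ≠ p' := fun h => hi (by rw [h])
    match j, j' with
    | Sum.inl ⟨_, (t, s), rfl⟩, Sum.inl ⟨_, (t', s'), rfl⟩ =>
      intro heq
      have h1 := (htw heq (ht p')).1
      rw [← Algebra.smul_def, ← Algebra.smul_def] at h1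
      exact t.ne_zero (smul_rep_eq_smul_rep hp h1).1
    | Sum.inl ts, Sum.inr x => exact (pairLine_ne_graph (hz p'.rep_nonzero x) _).symm
    | Sum.inr x, Sum.inl ts => exact pairLine_ne_graph (hz p.rep_nonzero x) _
    | Sum.inr x, Sum.inr x' =>
      intro heq
      obtain ⟨rfl, ⟨a, ha⟩, -⟩ := pairLine_eq heq
      rw [← smul_mul_assoc] at ha
      have h1 := mul_right_cancel₀ x.rep_nonzero ha
      exact one_ne_zero (smul_rep_eq_smul_rep hp (a := (1 : F)) (by rw [one_smul]; exact h1)).1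

end

theorem maxCodeSize_eight_ge {F : Type*} [Field F] [Finite F] {q : ℕ} (hF : Nat.card F = q)
    (hq : 3 ≤ q) :
    q ^ 12 + q ^ 2 * (q ^ 2 + 1) ^ 2 * (q ^ 2 + q + 1) + 1 ≤ maxCodeSize F 8 4 4 := by
  classical
  obtain ⟨p, hp⟩ := CharP.exists F
  have hprime : Fact p.Prime := ⟨CharP.char_is_prime F p⟩
  let K := FiniteField.Extension F p 2
  have hK : finrank F K = 2 := FiniteField.finrank_extension F p 2
  have hcardK : Nat.card K = q ^ 2 := (FiniteField.natCard_extension F p 2).trans (by rw [hF])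
  have hfK : Finite K := Module.finite_of_finite F
  have hfP : Finite (ℙ F K) := (Projectivization.finite_iff_of_finite F K).2 hfK
  obtain ⟨h, hh, hη⟩ := exists_twisted_end hK (hq.trans_eq hF.symm)
  have hcardP : Nat.card (ℙ F K) = q + 1 :=
    (Projectivization.card_of_finrank_two F K hK).trans (by rw [hF])
  have hcardF' : Nat.card Fˣ = q - 1 := by
    have := Fintype.ofFinite F
    rw [Nat.card_units, hF]
  have hcardK' : Nat.card Kˣ = q ^ 2 - 1 := by
    rw [Nat.card_units, hcardK]
  have hcompl : Nat.card {κ : K // κ ∉ Set.range (algebraMap F K)} = q ^ 2 - q := by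
    have h1 := Set.ncard_add_ncard_compl (Set.range (algebraMap F K))
    have h2 : (Set.range (algebraMap F K)).ncard = q := by
      rw [← Set.image_univ, Set.ncard_image_of_injective _ (algebraMap F K).injective,
        Set.ncard_univ, hF]
    rw [hcardK, h2] at h1
    have h3 : Nat.card {κ : K // κ ∉ Set.range (algebraMap F K)} =
      (Set.range (algebraMap F K))ᶜ.ncard := rfl
    omega
  have hfJ (i : ClassIndex F K) : Finite (LineIndex F K i) := by
    match i with
    | none => exact inferInstanceAs (Finite (Option K))
    | some (Sum.inl d) =>
      exact inferInstanceAs (Finite ({κ : K // κ ∉ Set.range (algebraMap F K)} ⊕ ℙ F K))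
    | some (Sum.inr p) => exact inferInstanceAs (Finite (scalarPairs F K ⊕ ℙ F K))
  have hqq : q ≤ q ^ 2 := Nat.le_self_pow two_ne_zero q
  have hcardJ (i : ClassIndex F K) : Nat.card (LineIndex F K i) = q ^ 2 + 1 := by
    match i with
    | none => exact (Finite.card_option (α := K)).trans (by rw [hcardK])
    | some (Sum.inl d) =>
      refine Nat.card_sum.trans ?_
      rw [hcompl, hcardP]
      omega
    | some (Sum.inr p) =>
      refine Nat.card_sum.trans ?_
      have hinj : Function.Injective fun ts : Fˣ × F =>
          (algebraMap F K ts.1, algebraMap F K ts.2) := by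
        rintro ⟨t, s⟩ ⟨t', s'⟩ heq
        rw [Prod.mk.injEq] at heq ⊢
        exact ⟨Units.ext ((algebraMap F K).injective heq.1), (algebraMap F K).injective heq.2⟩
      rw [Nat.card_range_of_injective hinj, Nat.card_prod, hcardF', hF, hcardP,
        Nat.sub_mul, one_mul, ← pow_two]
      omega
  have hcardI : Nat.card (ClassIndex F K) = q ^ 2 + q + 1 := by
    rw [Finite.card_option, Nat.card_sum, hcardK', hcardP]
    have : 0 < q ^ 2 := by positivity
    omega
  have := Fintype.ofFinite (ClassIndex F K)
  have hA : finrank F (K × K) = 4 := by rw [finrank_prod, hK]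
  refine le_trans (le_of_eq ?_) (code_of_parallelism hA (parallelLine h) (finrank_parallelLine hK h)
    (parallelLine_inf_eq_bot hh) (parallelLine_ne hh hη))
  rw [Nat.card_sigma, Finset.sum_congr rfl fun i _ => by rw [Nat.card_prod, hcardJ i],
    Finset.sum_const, Finset.card_univ, ← Nat.card_eq_fintype_card, hcardI, hF, smul_eq_mul]
  ring

/-! ### Binary vectors as natural numbers -/

/-- The vector of `F ^ 8` whose coordinates are the eight lowest binary digits of `a`. -/
def bitVec (F : Type*) [Field F] (a : ℕ) : Fin 8 → F :=
  fun i => if a.testBit i then 1 else 0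

theorem bitVec_zero (F : Type*) [Field F] : bitVec F 0 = 0 := by
  ext i
  simp [bitVec]

theorem bitVec_xor (F : Type*) [Field F] [CharP F 2] (a b : ℕ) :
    bitVec F (a ^^^ b) = bitVec F a + bitVec F b := by
  ext i
  simp only [bitVec, Nat.testBit_xor, Pi.add_apply]
  cases a.testBit i <;> cases b.testBit i <;> simp [CharTwo.add_self_eq_zero]

theorem bitVec_injOn (F : Type*) [Field F] {a b : ℕ} (ha : a < 256) (hb : b < 256)
    (h : bitVec F a = bitVec F b) : a = b := by
  refine Nat.eq_of_testBit_eq fun i => ?_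
  by_cases hi : i < 8
  · have := congrFun h ⟨i, hi⟩
    simp only [bitVec] at this
    cases h1 : a.testBit i <;> cases h2 : b.testBit i <;> simp_all
  · have h8 : 256 ≤ 2 ^ i := 
      (by norm_num : 256 = 2 ^ 8).trans_le (Nat.pow_le_pow_right two_pos (by omega))
    rw [Nat.testBit_eq_false_of_lt (ha.trans_le h8), Nat.testBit_eq_false_of_lt (hb.trans_le h8)]

theorem bitVec_two_pow (F : Type*) [Field F] (i : Fin 8) : bitVec F (2 ^ (i : ℕ)) = Pi.single i 1 := by
  ext j
  simp [bitVec, Nat.testBit_two_pow, Pi.single_apply, Fin.ext_iff, eq_comm]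

/-- The sums of the sublists of a list of bit vectors. -/
def bitSpan : List ℕ → List ℕ
  | [] => [0]
  | b :: l => bitSpan l ++ (bitSpan l).map (Nat.xor b)

/-- The natural number whose binary digits mark the members of a list. -/
def bitMask : List ℕ → ℕ
  | [] => 0
  | a :: l => Nat.lor (Nat.shiftLeft 1 a) (bitMask l)

/-- The set of vectors spanned by a list, as a `256`-bit number. -/
def spaceMask (b : List ℕ) : ℕ := bitMask (bitSpan b)

/-- The subspace spanned by a list of bit vectors. -/
def bitSpace (F : Type*) [Field F] (b : List ℕ) : Submodule F (Fin 8 → F) :=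
  Submodule.span F (bitVec F '' {a | a ∈ b})

theorem bitSpan_lt {b : List ℕ} (hb : ∀ a ∈ b, a < 256) : ∀ a ∈ bitSpan b, a < 256 := by
  induction b with
  | nil => simp [bitSpan]
  | cons x l ih =>
    have ih' := ih fun a ha => hb a (by simp [ha])
    have hx : x < 256 := hb x (by simp)
    intro a ha
    simp only [bitSpan, List.mem_append, List.mem_map] at ha
    obtain ha | ⟨c, hc, rfl⟩ := ha
    · exact ih' a ha
    · exact Nat.xor_lt_two_pow (n := 8) hx (ih' c hc)

theorem testBit_bitMask (l : List ℕ) (a : ℕ) : (bitMask l).testBit a = true ↔ a ∈ l := by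
  induction l with
  | nil => simp [bitMask]
  | cons x l ih =>
    have h1 : bitMask (x :: l) = (1 <<< x) ||| bitMask l := rfl
    rw [h1, Nat.testBit_or, Bool.or_eq_true, ih, Nat.one_shiftLeft, Nat.testBit_two_pow]
    simp [eq_comm]

theorem eq_zero_or_one {F : Type*} [Field F] [Fintype F] (hF : Fintype.card F = 2) (c : F) :
    c = 0 ∨ c = 1 := by
  classical
  by_contra h
  push Not at h
  have := Finset.card_le_univ ({0, 1, c} : Finset F)
  rw [Finset.card_eq_three.2 ⟨0, 1, c, zero_ne_one, h.1.symm, h.2.symm, rfl⟩, hF] at this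
  omega

theorem mem_bitSpace {F : Type*} [Field F] [Fintype F] [CharP F 2] (hF : Fintype.card F = 2)
    (b : List ℕ) (v : Fin 8 → F) : v ∈ bitSpace F b ↔ ∃ a ∈ bitSpan b, v = bitVec F a := by
  induction b generalizing v with
  | nil => simp [bitSpace, bitSpan, bitVec_zero]
  | cons x l ih =>
    have hset : bitVec F '' {a | a ∈ x :: l} = insert (bitVec F x) (bitVec F '' {a | a ∈ l}) := by
      ext w
      simp [eq_comm]
    unfold bitSpace at ih ⊢
    rw [hset, Submodule.mem_span_insert]
    simp only [bitSpan, List.mem_append, List.mem_map]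
    constructor
    · rintro ⟨c, z, hz, rfl⟩
      obtain ⟨a, ha, rfl⟩ := (ih z).1 hz
      obtain rfl | rfl := eq_zero_or_one hF c
      · exact ⟨a, Or.inl ha, by simp⟩
      · exact ⟨x ^^^ a, Or.inr ⟨a, ha, rfl⟩, by rw [bitVec_xor, one_smul]⟩
    · rintro ⟨a, ha | ⟨c, hc, rfl⟩, rfl⟩
      · exact ⟨0, bitVec F a, (ih _).2 ⟨a, ha, rfl⟩, by simp⟩
      · exact ⟨1, bitVec F c, (ih _).2 ⟨c, hc, rfl⟩, by
          rw [one_smul]; exact bitVec_xor F x c⟩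

/-- Clears the lowest binary digit `1`. -/
def clearLow (x : ℕ) : ℕ := Nat.land x (Nat.sub x 1)

/-- Clears the two lowest binary digits `1`. -/
def clearTwo (x : ℕ) : ℕ := clearLow (clearLow x)

/-- Whether at most four binary digits are `1`; numbers with at most two such digits, which are
the most frequent, are recognised first. -/
def atMostFour (x : ℕ) : Bool :=
  bif Nat.beq (clearTwo x) 0 then true else Nat.beq (clearTwo (clearTwo x)) 0

/-- `clearLow` clears at most one binary digit. -/
theorem exists_testBit_clearLow (x : ℕ) :
    ∃ i, ∀ a, x.testBit a = true → a = i ∨ (clearLow x).testBit a = true := by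
  induction x using Nat.strong_induction_on with
  | _ x ih =>
    change ∃ i, ∀ a, x.testBit a = true → a = i ∨ (x &&& (x - 1)).testBit a = true
    simp only [Nat.testBit_and, Bool.and_eq_true]
    obtain hx | hx := Nat.even_or_odd' x |>.choose_spec
    · set y := (Nat.even_or_odd' x).choose
      obtain h0 | hpos := Nat.eq_zero_or_pos y
      · exact ⟨0, fun a ha => by simp [hx, h0] at ha⟩
      obtain ⟨i, hi⟩ := ih y (by omega)
      refine ⟨i + 1, fun a ha => ?_⟩
      cases a with
      | zero => simp [hx] at ha
      | succ a =>
        have e1 : x / 2 = y := by omega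
        have e2 : (x - 1) / 2 = y - 1 := by omega
        rw [Nat.testBit_succ, e1] at ha
        have := hi a ha
        change a = i ∨ (y &&& (y - 1)).testBit a = true at this
        rw [Nat.testBit_and, Bool.and_eq_true] at this
        rw [Nat.testBit_succ, Nat.testBit_succ, e1, e2]
        simpa using this
    · set y := (Nat.even_or_odd' x).choose
      refine ⟨0, fun a ha => ?_⟩
      cases a with
      | zero => exact Or.inl rfl
      | succ a =>
        have e1 : x / 2 = y := by omega
        have e2 : (x - 1) / 2 = y := by omega
        rw [Nat.testBit_succ, e1] at ha
        rw [Nat.testBit_succ, Nat.testBit_succ, e1, e2]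
        simp [ha]

theorem card_testBit_le (x n : ℕ) :
    ((Finset.range n).filter fun a => x.testBit a = true).card ≤
      ((Finset.range n).filter fun a => (clearLow x).testBit a = true).card + 1 := by
  obtain ⟨i, hi⟩ := exists_testBit_clearLow x
  refine (Finset.card_le_card ?_).trans (Finset.card_insert_le i _)
  intro a ha
  simp only [Finset.mem_filter, Finset.mem_insert] at ha ⊢
  have := hi a ha.2
  tauto

theorem card_testBit_le_four {x : ℕ} (h : atMostFour x = true) (n : ℕ) :
    ((Finset.range n).filter fun a => x.testBit a = true).card ≤ 4 := by
  have h1 (y) := card_testBit_le y n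
  have h2 (y : ℕ) (hy : y = 0) : ((Finset.range n).filter fun a => y.testBit a = true).card = 0 := by
    simp [hy]
  have a1 := h1 x
  have a2 := h1 (clearLow x)
  have a3 := h1 (clearTwo x)
  have a4 := h1 (clearLow (clearTwo x))
  have h' : clearTwo x = 0 ∨ clearTwo (clearTwo x) = 0 := by
    unfold atMostFour at h
    by_cases h0 : clearTwo x = 0
    · exact Or.inl h0
    · have : Nat.beq (clearTwo x) 0 = false := by
        rw [Bool.eq_false_iff]
        exact fun h => h0 (Nat.eq_of_beq_eq_true h)
      rw [this] at h
      exact Or.inr (Nat.eq_of_beq_eq_true h)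
  obtain h' | h' := h'
  · have := h2 _ h'
    unfold clearTwo at this
    omega
  · have := h2 _ h'
    unfold clearTwo at *
    omega

/-- Two binary subspaces with at most four common vectors meet in dimension at most `2`. -/
theorem finrank_bitSpace_inf_le {F : Type*} [Field F] [Fintype F] [CharP F 2]
    (hF : Fintype.card F = 2) {b c : List ℕ} (hb : ∀ a ∈ b, a < 256)
    (h : atMostFour (Nat.land (spaceMask b) (spaceMask c)) = true) (hc : ∀ a ∈ c, a < 256) :
    finrank F ↥(bitSpace F b ⊓ bitSpace F c) ≤ 2 := by
  classical
  set X := (Finset.range 256).filter fun a =>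
    (Nat.land (spaceMask b) (spaceMask c)).testBit a = true
  have hsub : ((bitSpace F b ⊓ bitSpace F c : Submodule F (Fin 8 → F)) : Set (Fin 8 → F)) ⊆
      ↑(X.image (bitVec F)) := by
    rintro v ⟨hv1, hv2⟩
    obtain ⟨a, ha, rfl⟩ := (mem_bitSpace hF b v).1 hv1
    obtain ⟨a', ha', haa⟩ := (mem_bitSpace hF c _).1 hv2
    obtain rfl := bitVec_injOn F (bitSpan_lt hb a ha) (bitSpan_lt hc a' ha') haa
    simp only [Finset.coe_image, Set.mem_image, Finset.mem_coe]
    refine ⟨a, ?_, rfl⟩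
    simp only [X, Finset.mem_filter, Finset.mem_range]
    refine ⟨bitSpan_lt hb a ha, ?_⟩
    change ((spaceMask b) &&& (spaceMask c)).testBit a = true
    rw [Nat.testBit_and, Bool.and_eq_true]
    exact ⟨(testBit_bitMask _ _).2 ha, (testBit_bitMask _ _).2 ha'⟩
  have h1 := Set.ncard_le_ncard hsub (Finset.finite_toSet _)
  rw [Set.ncard_coe_finset] at h1
  have h2 : X.card ≤ 4 := card_testBit_le_four h 256
  have h3 := h1.trans (Finset.card_image_le.trans h2)
  have h4 : Set.ncard ((bitSpace F b ⊓ bitSpace F c : Submodule F (Fin 8 → F)) : Set (Fin 8 → F)) =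
      2 ^ finrank F ↥(bitSpace F b ⊓ bitSpace F c) := by
    have := Module.natCard_eq_pow_finrank (K := F) (V := ↥(bitSpace F b ⊓ bitSpace F c))
    rw [Nat.card_eq_fintype_card (α := F), hF] at this
    rw [← this]
    rfl
  rw [h4] at h3
  by_contra hlt
  have : 2 ^ 3 ≤ 2 ^ finrank F ↥(bitSpace F b ⊓ bitSpace F c) :=
    Nat.pow_le_pow_right (by norm_num) (by omega)
  omega

theorem finrank_bitSpace {F : Type*} [Field F] [Fintype F] [CharP F 2]
    (hF : Fintype.card F = 2) {b : List ℕ} (hb : ∀ a ∈ b, a < 256) (hlen : b.length = 4)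
    (hnd : (bitSpan b).Nodup) : finrank F (bitSpace F b) = 4 := by
  classical
  have hset : ((bitSpace F b : Submodule F (Fin 8 → F)) : Set (Fin 8 → F)) =
      ↑((bitSpan b).toFinset.image (bitVec F)) := by
    ext v
    simp only [SetLike.mem_coe, mem_bitSpace hF, Finset.coe_image, Set.mem_image, List.mem_toFinset]
    exact exists_congr fun a => by rw [eq_comm (a := v)]
  have hlen' (l : List ℕ) : (bitSpan l).length = 2 ^ l.length := by
    induction l with
    | nil => rfl
    | cons x l ih =>
      rw [bitSpan, List.length_append, List.length_map, ih, List.length_cons, pow_succ]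
      ring
  have hcard : Set.ncard ((bitSpace F b : Submodule F (Fin 8 → F)) : Set (Fin 8 → F)) = 16 := by
    rw [hset, Set.ncard_coe_finset, Finset.card_image_of_injOn, List.toFinset_card_of_nodup hnd,
      hlen', hlen]
    · norm_num
    intro x hx y hy hxy
    exact bitVec_injOn F (bitSpan_lt hb x (by simpa using hx)) (bitSpan_lt hb y (by simpa using hy))
      hxy
  have h1 := Module.natCard_eq_pow_finrank (K := F) (V := ↥(bitSpace F b))
  rw [Nat.card_eq_fintype_card (α := F), hF] at h1
  have h2 : Nat.card ↥(bitSpace F b) = 16 := hcard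
  rw [h2] at h1
  exact (Nat.pow_right_injective (le_refl 2) (h1.symm.trans (by norm_num : (16 : ℕ) = 2 ^ 4)))

/-! ### A binary code with 4801 codewords -/

/-- Entry number `a` of a table of bytes packed into one natural number. -/
def tableEntry (T a : ℕ) : ℕ := Nat.land (Nat.shiftRight T (Nat.mul 8 a)) 255

/-- Bytes are read as elements of `𝔽₂[X]/(X⁸+X⁴+X³+X²+1)`, the digit `2 ^ i` standing for `X ^ i`.
This
is the table of the multiplication by `X ^ 17`, an element of multiplicative order `15`. -/
def mulTable : ℕ :=
  0x821aaf37d840f56d36ae1b836cf441d9f76fda42ad35801843db6ef6198134ac68f045dd32aa1f87dc44f169861eab331d8530a847df6af2a931841cf36bde464bd366fe11893ca4ff67d24aa53d88103ea6138b64fc49d18a12a73fd048fd65a1398c14fb63d64e158d38a04fd762fad44cf9618e16a33b60f84dd53aa2178f0d9520b857cf7ae2b921940ce37bce5678e055cd22ba0f97cc54e179960ebb23e77fca52bd25900853cb7ee6099124bc920abf27c850e57d26be0b937ce451c9c45ce9719e06b32b70e85dc52ab2079fb1299c04eb73c65e059d28b05fc772ea2eb6039b74ec59c19a02b72fc058e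d755bc376ee01992cb4ef77c25ab52d9800

/-- The table of the squaring map of `𝔽₂[X]/(X⁸+X⁴+X³+X²+1)`. -/
def frobTable : ℕ :=
  0xe2e3e6e7f2f3f6f7a2a3a6a7b2b3b6b7fffefbfaefeeebeabfbebbbaafaeabaa9697929386878283d6d7d2d3c6c7c2c38b8a8f8e9b9a9f9ecbcacfcedbdadfde2f2e2b2a3f3e3b3a6f6e6b6a7f7e7b7a323336372223262772737677626366675b5a5f5e4b4a4f4e1b1a1f1e0b0a0f0e46474243565752530607020316171213f1f0f5f4e1e0e5e4b1b0b5b4a1a0a5a4ecede8e9fcfdf8f9acada8a9bcbdb8b98584818095949190c5c4c1c0d5d4d1d098999c9d88898c8dd8d9dcddc8c9cccd3c3d38392c2d28297c7d78796c6d68692120252431303534616065647170757448494c4d58595c5d08090c0d18191c1d55545150454441401514111005040100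

/-- Representatives of the orbits of the code under the group generated by the multiplication by
`X ^ 17` and the squaring map, each with two numbers `E` and `C`: the orbit consists of the images
of the representative under `f ^ e * g ^ c`, `e < E`, `c < C`, where `g` is the multiplication
and `f` the squaring. -/
def orbitReps : List (List ℕ × ℕ × ℕ) :=
  [([16, 9, 5, 3], 8, 15), ([34, 10, 6, 1], 8, 15), ([36, 24, 2, 1], 8, 15),
   ([41, 17, 5, 2], 8, 15), ([41, 25, 4, 3], 8, 15), ([32, 17, 5, 3], 8, 15),
   ([34, 22, 8, 1], 8, 15), ([32, 16, 12, 2], 8, 15), ([33, 20, 12, 3], 8, 15),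
   ([35, 17, 8, 4], 8, 15), ([34, 19, 8, 6], 8, 15), ([33, 18, 8, 5], 8, 15),
   ([35, 16, 11, 5], 8, 15), ([32, 16, 8, 7], 8, 15), ([114, 8, 4, 1], 8, 15),
   ([80, 10, 4, 1], 8, 15), ([106, 16, 6, 1], 8, 15), ([97, 17, 4, 2], 8, 15),
   ([104, 24, 5, 2], 8, 15), ([72, 16, 4, 3], 8, 15), ([65, 21, 8, 2], 8, 15),
   ([100, 21, 12, 2], 8, 15), ([97, 20, 8, 3], 8, 15), ([97, 21, 13, 3], 8, 15),
   ([64, 18, 10, 4], 8, 15), ([96, 16, 8, 6], 8, 15), ([66, 18, 10, 7], 8, 5),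
   ([72, 40, 2, 1], 8, 15), ([64, 32, 4, 2], 8, 15), ([72, 48, 4, 2], 8, 15),
   ([80, 57, 5, 2], 8, 15), ([89, 49, 4, 3], 8, 15), ([80, 48, 5, 3], 8, 15),
   ([86, 52, 10, 1], 4, 15), ([84, 49, 12, 2], 8, 15), ([80, 52, 12, 3], 8, 15),
   ([82, 49, 9, 5], 8, 15), ([83, 49, 8, 7], 8, 15), ([74, 34, 27, 4], 8, 15),
   ([75, 32, 19, 6], 8, 15), ([68, 39, 23, 12], 8, 15), ([69, 38, 17, 10], 4, 5),
   ([146, 68, 10, 1], 1, 1)]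

/-- Applies a table `n` times to all members of a list. -/
def iterTable (T : ℕ) : ℕ → List ℕ → List ℕ
  | 0, b => b
  | n + 1, b => iterTable T n (b.map (tableEntry T))

/-- The image of a list under `f ^ d * g ^ k`. -/
def translate (d k : ℕ) (b : List ℕ) : List ℕ :=
  iterTable frobTable d (iterTable mulTable k b)

/-- The space of `r` and its image `m` under `f ^ d * g ^ k` have at most four vectors in common,
unless `d` and `k` are not a difference of two index pairs of the orbit of `r`. -/
def selfSeparated (r : List ℕ × ℕ × ℕ) (d k m : ℕ) : Bool :=
  bif bif Nat.beq d 0 then Nat.beq (Nat.mod k r.2.2) 0 else Nat.beq (Nat.mod d r.2.1) 0 then true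
  else atMostFour (Nat.land (spaceMask r.1) m)

/-- All images of `r` under `f ^ d * g ^ k` are separated from `r` in the sense of `selfSeparated`
and have at most four vectors in common with the representatives in `l`. -/
def orbitSeparated (r : List ℕ × ℕ × ℕ) (l : List (List ℕ × ℕ × ℕ)) : Bool :=
  (List.range 8).all fun d => (List.range 15).all fun k =>
    selfSeparated r d k (spaceMask (translate d k r.1)) &&
      l.all fun s => atMostFour (Nat.land (spaceMask s.1) (spaceMask (translate d k r.1)))

/-- `orbitSeparated` for every member of a list and the members after it. -/
def orbitsSeparated : List (List ℕ × ℕ × ℕ) → Bool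
  | [] => true
  | r :: l => orbitSeparated r l && orbitsSeparated l

set_option maxRecDepth 10000 in
theorem orbitsSeparated_orbitReps : orbitsSeparated orbitReps = true := by decide +kernel

theorem tableEntry_lt (T a : ℕ) : tableEntry T a < 256 :=
  Nat.lt_succ_of_le (Nat.and_le_right (n := Nat.shiftRight T (Nat.mul 8 a)) (m := 255))

/-- The linear map of `F ^ 8` whose values on the standard basis are read off a table. -/
def tableMap (F : Type*) [Field F] (T : ℕ) : Module.End F (Fin 8 → F) :=
  Fintype.linearCombination F fun i : Fin 8 => bitVec F (tableEntry T (2 ^ (i : ℕ)))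

/-- A table is linear if its entries are the sums of its entries at powers of two. -/
def IsLinearTable (T : ℕ) : Prop :=
  ∀ a < 256, tableEntry T a = (List.range 8).foldr
    (fun i s => if a.testBit i then tableEntry T (2 ^ i) ^^^ s else s) 0

instance (T : ℕ) : Decidable (IsLinearTable T) := by unfold IsLinearTable; infer_instance

theorem isLinearTable_mulTable : IsLinearTable mulTable := by decide +kernel

theorem isLinearTable_frobTable : IsLinearTable frobTable := by decide +kernel

theorem end_ext_bitVec {F : Type*} [Field F] {φ ψ : Module.End F (Fin 8 → F)}
    (h : ∀ i < 8, φ (bitVec F (2 ^ i)) = ψ (bitVec F (2 ^ i))) : φ = ψ := by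
  refine LinearMap.pi_ext' fun i => LinearMap.ext_ring ?_
  have := h i i.2
  rwa [bitVec_two_pow] at this

theorem two_pow_lt {i : ℕ} (hi : i < 8) : 2 ^ i < 256 :=
  (Nat.pow_lt_pow_right (by norm_num) hi).trans_eq (by norm_num : 2 ^ 8 = 256)

section

variable (F : Type*) [Field F] [CharP F 2]

theorem bitVec_foldr (p : ℕ → Bool) (c : ℕ → ℕ) (l : List ℕ) :
    bitVec F (l.foldr (fun i s => if p i then c i ^^^ s else s) 0) =
      (l.map fun i => if p i then bitVec F (c i) else 0).sum := by
  induction l with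
  | nil => simp [bitVec_zero]
  | cons i l ih =>
    simp only [List.foldr_cons, List.map_cons, List.sum_cons]
    rw [← ih]
    split_ifs <;> simp [bitVec_xor]

theorem tableMap_bitVec {T : ℕ} (hT : IsLinearTable T) {a : ℕ} (ha : a < 256) :
    tableMap F T (bitVec F a) = bitVec F (tableEntry T a) := by
  rw [hT a ha, bitVec_foldr, tableMap, Fintype.linearCombination_apply]
  simp only [bitVec, ite_smul, one_smul, zero_smul]
  simp [Fin.sum_univ_eight, List.range_succ, add_assoc]

theorem tableMap_pow_bitVec {T : ℕ} (hT : IsLinearTable T) (n : ℕ) {a : ℕ} (ha : a < 256) :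
    (tableMap F T ^ n) (bitVec F a) = bitVec F ((tableEntry T)^[n] a) ∧
      (tableEntry T)^[n] a < 256 := by
  induction n with
  | zero => exact ⟨rfl, ha⟩
  | succ n ih =>
    rw [pow_succ', Module.End.mul_apply, ih.1, tableMap_bitVec F hT ih.2,
      Function.iterate_succ_apply']
    exact ⟨rfl, tableEntry_lt _ _⟩

theorem mulTable_pow : tableMap F mulTable ^ 15 = 1 := by
  refine end_ext_bitVec fun i hi => ?_
  rw [(tableMap_pow_bitVec F isLinearTable_mulTable 15 (two_pow_lt hi)).1]
  have : ∀ i < 8, (tableEntry mulTable)^[15] (2 ^ i) = 2 ^ i := by decide +kernel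
  rw [this i hi]
  rfl

theorem frobTable_pow : tableMap F frobTable ^ 8 = 1 := by
  refine end_ext_bitVec fun i hi => ?_
  rw [(tableMap_pow_bitVec F isLinearTable_frobTable 8 (two_pow_lt hi)).1]
  have : ∀ i < 8, (tableEntry frobTable)^[8] (2 ^ i) = 2 ^ i := by decide +kernel
  rw [this i hi]
  rfl

theorem mulTable_mul_frobTable :
    tableMap F mulTable * tableMap F frobTable = tableMap F frobTable * tableMap F mulTable ^ 8 := by
  refine end_ext_bitVec fun i hi => ?_
  have h8 := tableMap_pow_bitVec F isLinearTable_mulTable 8 (two_pow_lt hi)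
  rw [Module.End.mul_apply, Module.End.mul_apply, h8.1,
    tableMap_bitVec F isLinearTable_frobTable h8.2,
    tableMap_bitVec F isLinearTable_frobTable (two_pow_lt hi),
    tableMap_bitVec F isLinearTable_mulTable (tableEntry_lt _ _)]
  have : ∀ i < 8, tableEntry mulTable (tableEntry frobTable (2 ^ i)) =
      tableEntry frobTable ((tableEntry mulTable)^[8] (2 ^ i)) := by decide +kernel
  rw [this i hi]

theorem iterTable_lt (T n : ℕ) {b : List ℕ} (hb : ∀ a ∈ b, a < 256) :
    ∀ a ∈ iterTable T n b, a < 256 := by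
  induction n generalizing b with
  | zero => exact hb
  | succ n ih =>
    refine ih fun a ha => ?_
    obtain ⟨c, -, rfl⟩ := List.mem_map.1 ha
    exact tableEntry_lt _ _

theorem map_bitSpace {T : ℕ} (hT : IsLinearTable T) (n : ℕ) {b : List ℕ} (hb : ∀ a ∈ b, a < 256) :
    (bitSpace F b).map (tableMap F T ^ n) = bitSpace F (iterTable T n b) := by
  induction n generalizing b with
  | zero => exact Submodule.map_id _
  | succ n ih =>
    have h1 : (bitSpace F b).map (tableMap F T) = bitSpace F (b.map (tableEntry T)) := by
      unfold bitSpace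
      rw [Submodule.map_span, ← Set.image_comp]
      congr 1
      ext v
      simp only [Set.mem_image, Function.comp, Set.mem_ofPred_eq, List.mem_map]
      constructor
      · rintro ⟨a, ha, rfl⟩
        exact ⟨_, ⟨a, ha, rfl⟩, (tableMap_bitVec F hT (hb a ha)).symm⟩
      · rintro ⟨_, ⟨a, ha, rfl⟩, rfl⟩
        exact ⟨a, ha, tableMap_bitVec F hT (hb a ha)⟩
    rw [iterTable, ← ih (fun a ha => ?_), ← h1, pow_succ, Module.End.mul_eq_comp,
      Submodule.map_comp]
    obtain ⟨c, -, rfl⟩ := List.mem_map.1 ha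
    exact tableEntry_lt _ _

theorem map_translate (d k : ℕ) {b : List ℕ} (hb : ∀ a ∈ b, a < 256) :
    (bitSpace F b).map (tableMap F frobTable ^ d * tableMap F mulTable ^ k) =
      bitSpace F (translate d k b) := by
  rw [Module.End.mul_eq_comp, Submodule.map_comp, map_bitSpace F isLinearTable_mulTable k hb,
    map_bitSpace F isLinearTable_frobTable d (iterTable_lt _ _ hb)]
  rfl

end

/-- A monoid with elements `g`, `f` such that `g ^ 15 = 1`, `f ^ 8 = 1` and `g f = f g ^ 8`:
multiplying two products `f ^ e * g ^ c` by the inverse of the first. -/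
theorem exists_quotient {M : Type*} [Monoid M] {g f : M} (hg : g ^ 15 = 1) (hf : f ^ 8 = 1)
    (hgf : g * f = f * g ^ 8) {e c : ℕ} (he : e < 8) (hc : c < 15) (e' c' : ℕ) :
    ∃ p : M, p * (f ^ e * g ^ c) = 1 ∧ (f ^ e * g ^ c) * p = 1 ∧
      p * (f ^ e' * g ^ c') =
        f ^ ((8 - e + e') % 8) * g ^ (((15 - c) * 8 ^ ((8 - e + e') % 8) + c') % 15) := by
  have hgm (m : ℕ) : g ^ m * f = f * g ^ (m * 8) := by
    induction m with
    | zero => simp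
    | succ m ih => rw [pow_succ', mul_assoc, ih, ← mul_assoc, hgf, mul_assoc, ← pow_add]; ring_nf
  have hgd (m d : ℕ) : g ^ m * f ^ d = f ^ d * g ^ (m * 8 ^ d) := by
    induction d with
    | zero => simp
    | succ d ih =>
      rw [pow_succ, ← mul_assoc, ih, mul_assoc, hgm, ← mul_assoc, pow_succ, mul_assoc m]
  have hfe : f ^ (8 - e) * f ^ e = 1 := by rw [← pow_add, Nat.sub_add_cancel he.le, hf]
  have hef : f ^ e * f ^ (8 - e) = 1 := by rw [← pow_add, Nat.add_sub_cancel' he.le, hf]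
  have hgc : g ^ (15 - c) * g ^ c = 1 := by rw [← pow_add, Nat.sub_add_cancel hc.le, hg]
  have hcg : g ^ c * g ^ (15 - c) = 1 := by rw [← pow_add, Nat.add_sub_cancel' hc.le, hg]
  refine ⟨g ^ (15 - c) * f ^ (8 - e), ?_, ?_, ?_⟩
  · rw [mul_assoc, ← mul_assoc (f ^ _), hfe, one_mul, hgc]
  · rw [mul_assoc, ← mul_assoc (g ^ c), hcg, one_mul, hef]
  · rw [mul_assoc, ← mul_assoc (f ^ (8 - e)), ← pow_add, pow_eq_pow_mod (8 - e + e') hf,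
      ← mul_assoc, hgd, mul_assoc, ← pow_add, pow_eq_pow_mod _ hg]

theorem orbitsSeparated_iff (l : List (List ℕ × ℕ × ℕ)) : orbitsSeparated l = true ↔
    (∀ r ∈ l, ∀ d < 8, ∀ k < 15,
      selfSeparated r d k (spaceMask (translate d k r.1)) = true) ∧
    l.Pairwise fun r s => ∀ d < 8, ∀ k < 15,
      atMostFour (Nat.land (spaceMask s.1) (spaceMask (translate d k r.1))) = true := by
  induction l with
  | nil => simp [orbitsSeparated]
  | cons r l ih =>
    rw [orbitsSeparated, Bool.and_eq_true, ih, List.pairwise_cons]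
    simp only [orbitSeparated, List.all_eq_true, List.mem_range, Bool.and_eq_true, List.mem_cons,
      forall_eq_or_imp]
    constructor
    · rintro ⟨h1, h2, h3⟩
      exact ⟨⟨fun d hd k hk => (h1 d hd k hk).1, h2⟩,
        fun s hs d hd k hk => (h1 d hd k hk).2 s hs, h3⟩
    · rintro ⟨⟨h1, h2⟩, h3, h4⟩
      exact ⟨fun d hd k hk => ⟨h1 d hd k hk, fun s hs => h3 s hs d hd k hk⟩, h2, h4⟩

theorem orbitReps_basis : ∀ r ∈ orbitReps, (∀ a ∈ r.1, a < 256) ∧ r.1.length = 4 ∧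
    (bitSpan r.1).Nodup := by decide +kernel

theorem orbitReps_divisors : ∀ r ∈ orbitReps, r.2.1 ∣ 8 ∧ r.2.2 ∣ 15 := by decide +kernel

theorem sum_orbitReps : ∑ r : Fin orbitReps.length, orbitReps[r].2.1 * orbitReps[r].2.2 = 4801 := by
  decide +kernel

/-- Two numbers below a divisor `E` of `N` which are congruent modulo `E` are equal. -/
theorem eq_of_dvd_sub_mod {N E e e' : ℕ} (hE : E ∣ N) (hN : 0 < N) (he : e < E) (he' : e' < E)
    (h : E ∣ (N - e + e') % N) : e = e' := by
  rw [Nat.dvd_mod_iff hE] at h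
  have hEN := Nat.le_of_dvd hN hE
  have h1 : (E : ℤ) ∣ (N : ℤ) - e + e' := by
    have := Int.natCast_dvd_natCast.2 h
    rwa [Nat.cast_add, Nat.cast_sub (by omega)] at this
  have h2 : (E : ℤ) ∣ e' - e := by
    have := dvd_sub h1 (Int.natCast_dvd_natCast.2 hE)
    rwa [show (N : ℤ) - e + e' - N = e' - e by ring] at this
  have := Int.eq_zero_of_abs_lt_dvd h2 (by rw [abs_lt]; omega)
  omega

theorem binary_maxCodeSize_ge {F : Type*} [Field F] [Fintype F] (hF : Fintype.card F = 2) :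
    4801 ≤ maxCodeSize F 8 4 4 := by
  have : CharP F 2 := charP_of_card_eq_prime hF
  set g := tableMap F mulTable
  set f := tableMap F frobTable
  have hg : g ^ 15 = 1 := mulTable_pow F
  have hf : f ^ 8 = 1 := frobTable_pow F
  have hgf : g * f = f * g ^ 8 := mulTable_mul_frobTable F
  obtain ⟨hself, hpair⟩ := (orbitsSeparated_iff _).1 orbitsSeparated_orbitReps
  rw [List.pairwise_iff_getElem] at hpair
  let ι := Σ r : Fin orbitReps.length, Fin orbitReps[r].2.1 × Fin orbitReps[r].2.2
  have hmem (r : Fin orbitReps.length) : orbitReps[r] ∈ orbitReps := List.getElem_mem _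
  have hE (r : Fin orbitReps.length) : orbitReps[r].2.1 ∣ 8 := (orbitReps_divisors _ (hmem r)).1
  have hC (r : Fin orbitReps.length) : orbitReps[r].2.2 ∣ 15 := (orbitReps_divisors _ (hmem r)).2
  let U : ι → Submodule F (Fin 8 → F) := fun x =>
    (bitSpace F orbitReps[x.1].1).map (f ^ (x.2.1 : ℕ) * g ^ (x.2.2 : ℕ))
  have hlt (x : ι) : (x.2.1 : ℕ) < 8 ∧ (x.2.2 : ℕ) < 15 :=
    ⟨x.2.1.2.trans_le (Nat.le_of_dvd (by norm_num) (hE x.1)),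
      x.2.2.2.trans_le (Nat.le_of_dvd (by norm_num) (hC x.1))⟩
  have hinj {φ ψ : Module.End F (Fin 8 → F)} (h : ψ * φ = 1) : Function.Injective φ := by
    intro u v huv
    have := congrArg ψ huv
    rwa [← Module.End.mul_apply, ← Module.End.mul_apply, h] at this
  have hcard : Nat.card ι = 4801 := by
    rw [Nat.card_eq_fintype_card]
    simp only [ι, Fintype.card_sigma, Fintype.card_prod, Fintype.card_fin]
    exact sum_orbitReps
  rw [← hcard]
  refine card_le_maxCodeSize (by simp) U (fun x => ?_) ?_
  · obtain ⟨p, hp, -⟩ := exists_quotient hg hf hgf (hlt x).1 (hlt x).2 0 0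
    obtain ⟨h1, h2, h3⟩ := orbitReps_basis _ (hmem x.1)
    rw [← finrank_bitSpace hF h1 h2 h3]
    exact (Submodule.equivMapOfInjective _ (hinj hp) _).finrank_eq.symm
  -- It suffices to compare the members of an orbit with the representatives in the same or a
  -- later place of the list.
  have key (x y : ι) (hxy : x ≠ y) (hle : y.1 ≤ x.1) : finrank F ↥(U x ⊓ U y) ≤ 2 := by
    obtain ⟨p, hp, hp', hq⟩ := exists_quotient hg hf hgf (hlt x).1 (hlt x).2 y.2.1 y.2.2
    set d := (8 - (x.2.1 : ℕ) + y.2.1) % 8 with hd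
    set k := ((15 - (x.2.2 : ℕ)) * 8 ^ d + y.2.2) % 15 with hk
    have hd8 : d < 8 := Nat.mod_lt _ (by norm_num)
    have hk15 : k < 15 := Nat.mod_lt _ (by norm_num)
    obtain ⟨hbx, -⟩ := orbitReps_basis _ (hmem x.1)
    obtain ⟨hby, -⟩ := orbitReps_basis _ (hmem y.1)
    have hmap : (U x ⊓ U y).map p =
        bitSpace F orbitReps[x.1].1 ⊓ bitSpace F (translate d k orbitReps[y.1].1) := by
      rw [Submodule.map_inf _ (hinj hp'), ← map_translate F d k hby]
      congr 1
      · rw [← Submodule.map_comp, ← Module.End.mul_eq_comp, hp]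
        exact Submodule.map_id _
      · rw [← Submodule.map_comp, ← Module.End.mul_eq_comp, hq]
    rw [(Submodule.equivMapOfInjective _ (hinj hp') _).finrank_eq, hmap]
    refine finrank_bitSpace_inf_le hF hbx ?_ (iterTable_lt _ _ (iterTable_lt _ _ hby))
    obtain hlt' | heq := hle.lt_or_eq
    · exact hpair _ _ _ _ hlt' d hd8 k hk15
    · obtain ⟨i, e, c⟩ := x
      obtain ⟨i', e', c'⟩ := y
      obtain rfl : i' = i := heq
      have := hself _ (hmem i') d hd8 k hk15
      rw [selfSeparated] at this
      have hcond : (bif Nat.beq d 0 then Nat.beq (Nat.mod k orbitReps[i'].2.2) 0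
          else Nat.beq (Nat.mod d orbitReps[i'].2.1) 0) = false := by
        rw [Bool.eq_false_iff]
        intro hcond
        by_cases hd0 : d = 0
        · have hee : (e : ℕ) = e' := eq_of_dvd_sub_mod (dvd_refl 8) (by norm_num) (hlt ⟨i', e, c⟩).1
            (hlt ⟨i', e', c'⟩).1 (by change 8 ∣ d; rw [hd0]; exact dvd_zero 8)
          rw [hd0] at hcond
          have hk0 : k % orbitReps[i'].2.2 = 0 := Nat.eq_of_beq_eq_true hcond
          rw [hk, hd0, pow_zero, mul_one] at hk0
          have hcc : (c : ℕ) = c' := eq_of_dvd_sub_mod (hC i') (by norm_num) c.2 c'.2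
            (Nat.dvd_of_mod_eq_zero hk0)
          exact hxy (by rw [Fin.ext hee, Fin.ext hcc])
        · have hb : Nat.beq d 0 = false := by
            rw [Bool.eq_false_iff]
            exact fun h => hd0 (Nat.eq_of_beq_eq_true h)
          rw [hb] at hcond
          have hk0 : d % orbitReps[i'].2.1 = 0 := Nat.eq_of_beq_eq_true hcond
          have hee : (e : ℕ) = e' := eq_of_dvd_sub_mod (hE i') (by norm_num) e.2 e'.2
            (Nat.dvd_of_mod_eq_zero hk0)
          refine hd0 ?_
          have he8 := (hlt ⟨i', e, c⟩).1
          simp only [hd, hee] at he8 ⊢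
          omega
      rw [hcond] at this
      exact this
  intro x y hxy
  obtain h | h := le_total y.1 x.1
  · exact key x y hxy h
  · rw [inf_comm]
    exact key y x hxy.symm h

end SubspaceCode

theorem mainTheorem2 {F : Type*} [Field F] [Fintype F] (q : ℕ) (hq : Fintype.card F = q) :
    (SubspaceCode.maxCodeSize F 8 4 4 * q ^ 15 +
        q ^ 15 + 2 * q ^ 13 + 3 * q ^ 12 + 5 * q ^ 11 + q ^ 10 + 3 * q ^ 9 +
        6 * q ^ 8 + 7 * q ^ 7 + 5 * q ^ 6 + 3 * q ^ 5 + 3 * q ^ 4 + q ^ 3 + 1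
        ≤ SubspaceCode.maxCodeSize F 13 4 4) ∧
    (SubspaceCode.maxCodeSize F 8 4 4 * q ^ 18 +
        q ^ 18 + 2 * q ^ 16 + 3 * q ^ 15 + 5 * q ^ 14 + q ^ 13 + 4 * q ^ 12 +
        6 * q ^ 11 + 10 * q ^ 10 + 8 * q ^ 9 + 8 * q ^ 8 + 4 * q ^ 7 + 2 * q ^ 6 +
        q ^ 5 + 2 * q ^ 4 + q ^ 2 + 1
        ≤ SubspaceCode.maxCodeSize F 14 4 4) ∧
    (SubspaceCode.maxCodeSize F 8 4 4 * q ^ 21 +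
        q ^ 21 + 2 * q ^ 19 + 3 * q ^ 18 + 5 * q ^ 17 + q ^ 16 + 4 * q ^ 15 +
        6 * q ^ 14 + 11 * q ^ 13 + 10 * q ^ 12 + 12 * q ^ 11 + 9 * q ^ 10 + 8 * q ^ 9 +
        4 * q ^ 8 + 3 * q ^ 7 + 2 * q ^ 6 + q ^ 5 + q ^ 4 + q ^ 3 + q ^ 2 + 2 * q + 1
        ≤ SubspaceCode.maxCodeSize F 15 4 4) ∧
    (q = 2 → 157396313 ≤ SubspaceCode.maxCodeSize F 13 4 4) ∧
    (q = 3 → 7793514240823 ≤ SubspaceCode.maxCodeSize F 13 4 4) ∧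
    (q = 4 → 18118665490931521 ≤ SubspaceCode.maxCodeSize F 13 4 4) ∧
    (q = 5 → 7466568820575245751 ≤ SubspaceCode.maxCodeSize F 13 4 4) ∧
    (q = 7 → 65745512221518213208951 ≤ SubspaceCode.maxCodeSize F 13 4 4) ∧
    (q = 8 → 2418546150658513179095553 ≤ SubspaceCode.maxCodeSize F 13 4 4) ∧
    (q = 9 → 58159941504105053602711351 ≤ SubspaceCode.maxCodeSize F 13 4 4) ∧
    (q = 2 → 1259180741 ≤ SubspaceCode.maxCodeSize F 14 4 4) ∧
    (q = 3 → 210424885305967 ≤ SubspaceCode.maxCodeSize F 14 4 4) ∧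
    (q = 4 → 1159594591440676369 ≤ SubspaceCode.maxCodeSize F 14 4 4) ∧
    (q = 5 → 933321102572187066901 ≤ SubspaceCode.maxCodeSize F 14 4 4) ∧
    (q = 7 → 22550710691980761970230475 ≤ SubspaceCode.maxCodeSize F 14 4 4) ∧
    (q = 8 → 1238295629137158820126564417 ≤ SubspaceCode.maxCodeSize F 14 4 4) ∧
    (q = 9 → 42398597356492584370649345569 ≤ SubspaceCode.maxCodeSize F 14 4 4) ∧
    (q = 2 → 10073479745 ≤ SubspaceCode.maxCodeSize F 15 4 4) ∧
    (q = 3 → 5681471907063670 ≤ SubspaceCode.maxCodeSize F 15 4 4) ∧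
    (q = 4 → 74214053852327765337 ≤ SubspaceCode.maxCodeSize F 15 4 4) ∧
    (q = 5 → 116665137821525349488286 ≤ SubspaceCode.maxCodeSize F 15 4 4) ∧
    (q = 7 → 7734893767349401489942798302 ≤ SubspaceCode.maxCodeSize F 15 4 4) ∧
    (q = 8 → 634007362118225316632582459985 ≤ SubspaceCode.maxCodeSize F 15 4 4) ∧
    (q = 9 → 30908577472883094009455515497142 ≤ SubspaceCode.maxCodeSize F 15 4 4) := by
  have hF : Nat.card F = q := by rw [Nat.card_eq_fintype_card, hq]
  have h13 := SubspaceCode.maxCodeSize_13_ge F hF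
  have h14 := SubspaceCode.maxCodeSize_14_ge F hF
  have h15 := SubspaceCode.maxCodeSize_15_ge F hF
  have h2 (h : q = 2) : 4801 ≤ SubspaceCode.maxCodeSize F 8 4 4 :=
    SubspaceCode.binary_maxCodeSize_ge (hq.trans h)
  have h3 (h : 3 ≤ q) := SubspaceCode.maxCodeSize_eight_ge hF h
  clear hF hq
  refine ⟨by linarith only [h13], by linarith only [h14], by linarith only [h15], ?_, ?_, ?_, ?_,
    ?_, ?_, ?_, ?_, ?_, ?_, ?_, ?_, ?_, ?_, ?_, ?_, ?_, ?_, ?_, ?_, ?_⟩ <;> rintro rfl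
  · linarith only [h2 rfl, h13]
  · linarith only [h3 (by norm_num), h13]
  · linarith only [h3 (by norm_num), h13]
  · linarith only [h3 (by norm_num), h13]
  · linarith only [h3 (by norm_num), h13]
  · linarith only [h3 (by norm_num), h13]
  · linarith only [h3 (by norm_num), h13]
  · linarith only [h2 rfl, h14]
  · linarith only [h3 (by norm_num), h14]
  · linarith only [h3 (by norm_num), h14]
  · linarith only [h3 (by norm_num), h14]
  · linarith only [h3 (by norm_num), h14]
  · linarith only [h3 (by norm_num), h14]
  · linarith only [h3 (by norm_num), h14]
  · linarith only [h2 rfl, h15]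
  · linarith only [h3 (by norm_num), h15]
  · linarith only [h3 (by norm_num), h15]
  · linarith only [h3 (by norm_num), h15]
  · linarith only [h3 (by norm_num), h15]
  · linarith only [h3 (by norm_num), h15]
  · linarith only [h3 (by norm_num), h15]
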